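/- All graphs are finite and simple. A \emph{tree-decomposition} of a graph $G$ is a pair $(T,(V_t)_{t\in T})$ of a tree $T$ and vertex sets $V_t\subseteq V(G)$, one for every node $t$ of $T$ (its \emph{parts}), such that (T1) $V(G)=\bigcup_{t\in T}V_t$; (T2) for every edge $e$ of $G$ there is a $t\in T$ with $e\subseteq V_t$; (T3) $V_{t_1}\cap V_{t_3}\subseteq V_{t_2}$ whenever $t_2$ lies on the $t_1$--$t_3$ path in $T$. Its \emph{width} is $\max_{t\in T}(|V_t|-1)$, and it is \emph{connected} if every part $V_t$ induces a connected subgraph of $G$. The \emph{tree-width} $\mathrm{tw}(G)$ is the minimum width of a tree-decomposition of $G$, and the \emph{connected tree-width} $\mathrm{ctw}(G)$ is the minimum width of a connected tree-decomposition of $G$. The \emph{cycle space} of $G$ is the subspace of the edge space $\mathbb{F}_2^{E(G)}$ spanned by the edge sets of all cycles of $G$, and $\ell(G)$ is the smallest natural number $\ell$ such that the cycles of $G$ of length at most $\ell$ generate the cycle space of $G$. \textbf{Theorem.} Let $G$ be a graph containing a cycle. Then $$\mathrm{ctw}(G)\le \mathrm{tw}(G)\,(\ell(G)-2).$$ -/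

import Mathlib

namespace SimpleGraph

universe u

/-- A tree-decomposition of `G` over a tree with node set `ι`. -/
structure TreeDecomposition {V : Type u} (G : SimpleGraph V) (ι : Type) where
  /-- the decomposition tree -/
  tree : SimpleGraph ι
  isTree : tree.IsTree
  /-- the part belonging to a node of the tree -/
  part : ι → Set V
  exists_mem_part : ∀ v : V, ∃ t, v ∈ part t
  exists_adj_mem_part : ∀ v w : V, G.Adj v w → ∃ t, v ∈ part t ∧ w ∈ part t
  inter_subset_part : ∀ (t₁ t₃ : ι) (p : tree.Walk t₁ t₃), p.IsPath →
    ∀ t₂ ∈ p.support, part t₁ ∩ part t₃ ⊆ part t₂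

namespace TreeDecomposition

variable {V : Type u} {G : SimpleGraph V} {ι : Type}

/-- The width `max_t (|V_t| - 1)`. It is used for finite graphs and finite trees only; there, as soon
as `G` has a vertex, some part is non-empty and the truncation of the subtraction is harmless. -/
noncomputable def width (D : TreeDecomposition G ι) : ℕ :=
  ⨆ t, ((D.part t).ncard - 1)

/-- A tree-decomposition is connected if every part induces a connected (in particular non-empty)
subgraph of `G`. -/
def IsConnected (D : TreeDecomposition G ι) : Prop :=
  ∀ t, (G.induce (D.part t)).Connected

end TreeDecomposition

variable {V : Type u}

/-- The widths of the tree-decompositions of `G` (over finite trees). -/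
def treeDecompositionWidths (G : SimpleGraph V) : Set ℕ :=
  {k | ∃ (ι : Type) (_ : Finite ι) (D : TreeDecomposition G ι), D.width = k}

/-- The widths of the connected tree-decompositions of `G` (over finite trees). -/
def connectedTreeDecompositionWidths (G : SimpleGraph V) : Set ℕ :=
  {k | ∃ (ι : Type) (_ : Finite ι) (D : TreeDecomposition G ι), D.IsConnected ∧ D.width = k}

/-- The tree-width of a finite graph: the minimum width of a tree-decomposition. -/
noncomputable def treeWidth (G : SimpleGraph V) : ℕ :=
  sInf G.treeDecompositionWidths

/-- The connected tree-width of a finite graph: the minimum width of a connected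
tree-decomposition. -/
noncomputable def connectedTreeWidth (G : SimpleGraph V) : ℕ :=
  sInf G.connectedTreeDecompositionWidths

/-- The minimum in the definition of `connectedTreeWidth` is over a non-empty set: take the vertex
sets of the components as the parts and any tree on the set of components. -/
theorem connectedTreeDecompositionWidths_nonempty [Finite V] [Nonempty V] (G : SimpleGraph V) :
    G.connectedTreeDecompositionWidths.Nonempty := by
  obtain ⟨n, ⟨e⟩⟩ := Finite.exists_equiv_fin G.ConnectedComponent
  obtain ⟨v₀⟩ := ‹Nonempty V›
  let r : Fin n := e (G.connectedComponentMk v₀)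
  refine ⟨_, Fin n, inferInstance,
    { tree := starGraph r
      isTree := isTree_starGraph r
      part := fun t => (e.symm t).supp
      exists_mem_part := fun v => ⟨e (G.connectedComponentMk v), by simp⟩
      exists_adj_mem_part := fun v w h => ⟨e (G.connectedComponentMk v), by
        simpa using h.symm.reachable⟩
      inter_subset_part := ?_ }, ?_, rfl⟩
  · intro t₁ t₃ p hp t₂ h₂ v hv
    have h : t₁ = t₃ := e.symm.injective (hv.1.symm.trans hv.2)
    subst h
    rw [Walk.isPath_iff_nil, ← Walk.eq_nil_iff_nil] at hp
    subst hp
    simp only [Walk.support_nil, List.mem_singleton] at h₂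
    subst h₂
    exact hv.1
  · intro t
    exact (e.symm t).connected_toSimpleGraph

theorem treeDecompositionWidths_nonempty [Finite V] [Nonempty V] (G : SimpleGraph V) :
    G.treeDecompositionWidths.Nonempty := by
  obtain ⟨k, ι, h, D, -, hD⟩ := G.connectedTreeDecompositionWidths_nonempty
  exact ⟨k, ι, h, D, hD⟩

open Classical in
/-- The edge set of a walk, as an element of the edge space over `𝔽₂`; vectors in the edge space are
extended by zero to all unordered pairs of vertices. For a cycle `c` this is the edge set `E(c)`. -/
noncomputable def Walk.edgeVector {G : SimpleGraph V} {v w : V} (p : G.Walk v w) :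
    Sym2 V → ZMod 2 :=
  fun e => if e ∈ p.edges then 1 else 0

/-- The cycle space of `G`: the subspace of the edge space over `𝔽₂` spanned by the edge sets of
all cycles of `G`. -/
def cycleSpace (G : SimpleGraph V) : Submodule (ZMod 2) (Sym2 V → ZMod 2) :=
  Submodule.span (ZMod 2) {x | ∃ (v : V) (c : G.Walk v v), c.IsCycle ∧ c.edgeVector = x}

/-- The cycles of `G` of length at most `l` generate the cycle space of `G`. -/
def CyclesGenerate (G : SimpleGraph V) (l : ℕ) : Prop :=
  Submodule.span (ZMod 2)
    {x | ∃ (v : V) (c : G.Walk v v), c.IsCycle ∧ c.length ≤ l ∧ c.edgeVector = x} = G.cycleSpace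

/-- `ℓ(G)`: the least `l` such that the cycles of length at most `l` generate the cycle space. -/
noncomputable def cycleGeneratingLength (G : SimpleGraph V) : ℕ :=
  sInf {l | G.CyclesGenerate l}

end SimpleGraph

/-! Let w be the tree-width, ℓ = `cycleGeneratingLength` and m = ℓ - 3. Every part, of at most w + 1
vertices, is enlarged to the vertex set of a tree in `G` by adding paths of length at most ℓ - 2.
Naively, w paths with at most m new vertices each give w + 1 + wm = w(ℓ - 2) + 1 vertices. It
remains to find short paths and to preserve (T3).

Short paths. In a decomposition of a component that minimises the sum of squares of the part sizes,
both sides of every tree edge are connected (`exists_sidesConnected`). Root the tree, split a part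
into A and A', and take a shortest A–A' path in the cone of its node. Unless it is a single edge,
its interior lies in the set D of vertices in the cone of some child but not in the part, and the
other side of that tree edge provides a return path avoiding D. The resulting cycle has exactly one
A–D edge. The parity of the number of A–D edges is linear on the cycle space, so some cycle of
length at most ℓ also has an odd number of them. This forces it to contain an A–A' path inside A ∪ D
∪ A', which leaves out two of its edges unless its ends are adjacent
(`CyclesGenerate.exists_walk_length_le`, `exists_walk_cone_length_le`).

Preserving (T3). A vertex added at a node must reappear further down until a part already contains
it. So the forest at a child extends the restriction of its parent's forest to the child's cone.
Inherited vertices break the naive count, but a ratio survives: in each lower cone the forest has at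
most m/(m+1) times as many vertices off the part as it has edges (`IsScaffold.count`). A path
contributing k > 0 new vertices there contributes at least k + 1 edges, and k ≤ m. Since a tree has
one edge fewer than vertices, the same bound results (`IsScaffold.ncard_le`). The components are
finally joined along a tree. -/

namespace SimpleGraph

/-! ### Connected vertex sets -/

section ConnectedOn

variable {V : Type*} {G : SimpleGraph V}

/-- A vertex set is connected if it is not the union of two disjoint non-empty sets without an edge
between them. -/
def ConnectedOn (G : SimpleGraph V) (B : Set V) : Prop :=
  ∀ C ⊆ B, C.Nonempty → (∀ a ∈ C, ∀ b ∈ B, G.Adj a b → b ∈ C) → C = B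

theorem ConnectedOn.exists_walk {B : Set V} (hB : G.ConnectedOn B) {a b : V} (ha : a ∈ B)
    (hb : b ∈ B) : ∃ p : G.Walk a b, ∀ x ∈ p.support, x ∈ B := by
  have h := hB {x | x ∈ B ∧ ∃ p : G.Walk a x, ∀ y ∈ p.support, y ∈ B} (fun x hx => hx.1)
    ⟨a, ha, .nil, by simpa using ha⟩ (by
      rintro x ⟨hx, p, hp⟩ y hy hxy
      refine ⟨hy, p.concat hxy, ?_⟩
      intro z hz
      rw [Walk.support_concat] at hz
      simp only [List.mem_append, List.mem_singleton] at hz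
      rcases hz with hz | rfl
      exacts [hp z hz, hy])
  rw [← h] at hb
  exact hb.2

theorem ConnectedComponent.connectedOn_supp (c : G.ConnectedComponent) :
    G.ConnectedOn c.supp := by
  intro C hC ⟨a, ha⟩ hcl
  refine hC.antisymm fun b hb => ?_
  obtain ⟨p⟩ : G.Reachable a b := by
    have h1 := hC ha
    rw [ConnectedComponent.mem_supp_iff] at h1 hb
    exact ConnectedComponent.exact (h1.trans hb.symm)
  clear hb
  induction p with
  | nil => exact ha
  | cons h p ih =>
    refine ih (hcl _ ha _ ?_ h)
    have := hC ha
    rw [ConnectedComponent.mem_supp_iff] at this ⊢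
    rw [← this]
    exact ConnectedComponent.sound h.symm.reachable

end ConnectedOn

/-! ### Joining two trees by an edge -/

theorem IsTree.sum_sup_edge {α β : Type*} [Finite α] [Finite β] {S : SimpleGraph α}
    {T : SimpleGraph β} (hS : S.IsTree) (hT : T.IsTree) (a : α) (b : β) :
    ((S ⊕g T) ⊔ edge (Sum.inl a) (Sum.inr b)).IsTree := by
  have hc := hS.connected.sum_sup_edge hT.connected (v := a) (w := b)
  refine isTree_iff_connected_and_card.2 ⟨hc, le_antisymm ?_ hc.card_vert_le_card_edgeSet_add_one⟩
  have h₁ := (isTree_iff_connected_and_card.1 hS).2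
  have h₂ := (isTree_iff_connected_and_card.1 hT).2
  have h₃ : Nat.card (S ⊕g T).edgeSet = Nat.card S.edgeSet + Nat.card T.edgeSet := by
    rw [Nat.card_congr edgeSetSumEquiv, Nat.card_sum]
  have h₄ : Nat.card ((S ⊕g T) ⊔ edge (Sum.inl a) (Sum.inr b)).edgeSet ≤
      Nat.card (S ⊕g T).edgeSet + 1 := by
    rw [Nat.card_coe_set_eq, Nat.card_coe_set_eq, edgeSet_sup]
    refine (Set.ncard_union_le _ _).trans ?_
    gcongr
    rw [edgeSet_edge_of_ne (by simp)]
    simp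
  rw [Nat.card_sum]
  omega

theorem Walk.exists_sum_sup_edge_inl {α β : Type*} {S : SimpleGraph α} (T : SimpleGraph β)
    {x y : α} (p : S.Walk x y) (a : α) (b : β) :
    ∃ q : ((S ⊕g T) ⊔ edge (Sum.inl a) (Sum.inr b)).Walk (Sum.inl x) (Sum.inl y),
      ∀ z ∈ q.support, ∃ u ∈ p.support, z = Sum.inl u := by
  induction p with
  | nil => exact ⟨.nil, by simp⟩
  | @cons x y z h p ih =>
    obtain ⟨q, hq⟩ := ih
    refine ⟨.cons (Or.inl (by simpa using h)) q, ?_⟩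
    simp only [Walk.support_cons, List.mem_cons]
    rintro w (rfl | hw)
    · exact ⟨x, by simp, rfl⟩
    · obtain ⟨u, hu, rfl⟩ := hq w hw
      exact ⟨u, Or.inr hu, rfl⟩

theorem Walk.exists_sum_sup_edge_inr {α β : Type*} (S : SimpleGraph α) {T : SimpleGraph β}
    {x y : β} (p : T.Walk x y) (a : α) (b : β) :
    ∃ q : ((S ⊕g T) ⊔ edge (Sum.inl a) (Sum.inr b)).Walk (Sum.inr x) (Sum.inr y),
      ∀ z ∈ q.support, ∃ u ∈ p.support, z = Sum.inr u := by
  induction p with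
  | nil => exact ⟨.nil, by simp⟩
  | @cons x y z h p ih =>
    obtain ⟨q, hq⟩ := ih
    refine ⟨.cons (Or.inl (by simpa using h)) q, ?_⟩
    simp only [Walk.support_cons, List.mem_cons]
    rintro w (rfl | hw)
    · exact ⟨x, by simp, rfl⟩
    · obtain ⟨u, hu, rfl⟩ := hq w hw
      exact ⟨u, Or.inr hu, rfl⟩

/-! ### Tree-decompositions of vertex sets -/

/-- A tree-decomposition of the vertex set `K`, which in the applications is closed under adjacency.
The nodes containing a given vertex are connected by walks of the tree. -/
structure SetTreeDecomposition {V : Type*} (G : SimpleGraph V) (K : Set V) (ι : Type) where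
  /-- the decomposition tree -/
  tree : SimpleGraph ι
  isTree : tree.IsTree
  /-- the part belonging to a node of the tree -/
  part : ι → Set V
  part_subset : ∀ t, part t ⊆ K
  exists_mem_part : ∀ v ∈ K, ∃ t, v ∈ part t
  exists_adj_mem_part : ∀ v ∈ K, ∀ w, G.Adj v w → ∃ t, v ∈ part t ∧ w ∈ part t
  exists_walk : ∀ v t₁ t₂, v ∈ part t₁ → v ∈ part t₂ →
    ∃ p : tree.Walk t₁ t₂, ∀ t ∈ p.support, v ∈ part t

namespace SetTreeDecomposition

variable {V : Type*} {G : SimpleGraph V} {K : Set V} {ι : Type}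

/-- The union of the parts over a set of nodes. -/
def region (D : SetTreeDecomposition G K ι) (M : Set ι) : Set V := {v | ∃ t ∈ M, v ∈ D.part t}

/-- `M` is one of the two sides of the edge of the tree from `s` to `r`, the one containing `r`. -/
structure IsSide (D : SetTreeDecomposition G K ι) (M : Set ι) (s r : ι) : Prop where
  adj : D.tree.Adj s r
  left_notMem : s ∉ M
  right_mem : r ∈ M
  eq_of_adj : ∀ y z, D.tree.Adj y z → y ∉ M → z ∈ M → y = s ∧ z = r

theorem IsSide.compl {D : SetTreeDecomposition G K ι} {M : Set ι} {s r : ι} (h : D.IsSide M s r) :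
    D.IsSide Mᶜ r s where
  adj := h.adj.symm
  left_notMem := fun h' => h' h.right_mem
  right_mem := h.left_notMem
  eq_of_adj := fun y z hyz hy hz => (h.eq_of_adj z y hyz.symm hz (not_not.1 hy)).symm

theorem IsSide.mem_support_of_walk {D : SetTreeDecomposition G K ι} {M : Set ι} {s r : ι}
    (h : D.IsSide M s r) {t u : ι} (p : D.tree.Walk t u) (ht : t ∉ M) (hu : u ∈ M) :
    s ∈ p.support ∧ r ∈ p.support := by
  induction p with
  | nil => exact absurd hu ht
  | @cons x y z hxy p ih =>
    by_cases hy : y ∈ M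
    · obtain ⟨rfl, rfl⟩ := h.eq_of_adj _ _ hxy ht hy
      simp
    · have := ih hy hu
      simp [this.1, this.2]

theorem IsSide.mem_part {D : SetTreeDecomposition G K ι} {M : Set ι} {s r : ι}
    (h : D.IsSide M s r) {v : V} {t u : ι} (ht : t ∉ M) (hu : u ∈ M) (hvt : v ∈ D.part t)
    (hvu : v ∈ D.part u) : v ∈ D.part s ∧ v ∈ D.part r := by
  obtain ⟨p, hp⟩ := D.exists_walk v t u hvt hvu
  have := h.mem_support_of_walk p ht hu
  exact ⟨hp _ this.1, hp _ this.2⟩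

theorem region_subset (D : SetTreeDecomposition G K ι) (M : Set ι) : D.region M ⊆ K := by
  rintro v ⟨t, -, hv⟩
  exact D.part_subset t hv

/-- Edges at a vertex that lies on one side only stay on that side. -/
theorem IsSide.mem_region_of_adj {D : SetTreeDecomposition G K ι} {M : Set ι} {s r : ι}
    (h : D.IsSide M s r) {v w : V} (hv : v ∈ D.region M) (hv' : ¬ (v ∈ D.part s ∧ v ∈ D.part r))
    (hvw : G.Adj v w) : w ∈ D.region M := by
  obtain ⟨u, hu, hvu⟩ := hv
  obtain ⟨t, hvt, hwt⟩ := D.exists_adj_mem_part v (D.part_subset u hvu) w hvw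
  by_cases ht : t ∈ M
  · exact ⟨t, ht, hwt⟩
  · exact absurd (h.mem_part ht hu hvt hvu) hv'

/-- A side that splits into two parts without edges between them splits the part at its end. -/
theorem IsSide.exists_mem_part_of_closed {D : SetTreeDecomposition G K ι} {M : Set ι} {s r : ι}
    (h : D.IsSide M s r) (hK : G.ConnectedOn K) {C : Set V} (hC : C ⊆ D.region M)
    (hne : C.Nonempty) (hcl : ∀ a ∈ C, ∀ b ∈ D.region M, G.Adj a b → b ∈ C)
    (hCne : C ≠ D.region M) : ∃ v ∈ C, v ∈ D.part r := by
  by_contra! hcon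
  have : C = K := hK C (hC.trans (D.region_subset M)) hne fun a ha b _ hab =>
    hcl a ha b (h.mem_region_of_adj (hC ha) (fun h' => hcon a ha h'.2) hab) hab
  exact hCne (hC.antisymm (this ▸ D.region_subset M))

/-- The homomorphism from a tree to the join of two copies of it that takes a side to the second
copy. -/
noncomputable def IsSide.toSum {D : SetTreeDecomposition G K ι} {M : Set ι} {s r : ι}
    (h : D.IsSide M s r) :
    D.tree →g ((D.tree ⊕g D.tree) ⊔ edge (Sum.inl s) (Sum.inr r)) := by
  classical
  exact
  { toFun := fun t => if t ∈ M then Sum.inr t else Sum.inl t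
    map_rel' := by
      intro y z hyz
      by_cases hy : y ∈ M <;> by_cases hz : z ∈ M
      · simp [hy, hz, hyz]
      · obtain ⟨rfl, rfl⟩ := h.eq_of_adj z y hyz.symm hz hy
        simp [hy, hz, edge_adj]
      · obtain ⟨rfl, rfl⟩ := h.eq_of_adj y z hyz hy hz
        simp [hy, hz, edge_adj]
      · simp [hy, hz, hyz] }

theorem IsSide.toSum_of_mem {D : SetTreeDecomposition G K ι} {M : Set ι} {s r : ι}
    (h : D.IsSide M s r) {t : ι} (ht : t ∈ M) : h.toSum t = Sum.inr t := if_pos ht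

theorem IsSide.toSum_of_notMem {D : SetTreeDecomposition G K ι} {M : Set ι} {s r : ι}
    (h : D.IsSide M s r) {t : ι} (ht : t ∉ M) : h.toSum t = Sum.inl t := if_neg ht

/-- Splitting off `C` from one side of an edge of the tree. -/
noncomputable def split [Finite ι] (D : SetTreeDecomposition G K ι) {M : Set ι} {s r : ι}
    (h : D.IsSide M s r) (C : Set V)
    (hcl : ∀ a ∈ C, ∀ b ∈ D.region M, G.Adj a b → b ∈ C) :
    SetTreeDecomposition G K (ι ⊕ ι) where
  tree := (D.tree ⊕g D.tree) ⊔ edge (Sum.inl s) (Sum.inr r)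
  isTree := D.isTree.sum_sup_edge D.isTree s r
  -- The first copy loses `C` on the side `M`; the second carries exactly what was lost, and its
  -- parts outside `M` are empty. These empty parts are the reason for `prune`.
  part := Sum.elim (fun t => {v ∈ D.part t | t ∈ M → v ∉ C}) (fun t => {v ∈ D.part t | t ∈ M ∧ v ∈ C})
  part_subset := by
    rintro (t | t) v hv
    exacts [D.part_subset t hv.1, D.part_subset t hv.1]
  exists_mem_part := by
    intro v hv
    obtain ⟨t, ht⟩ := D.exists_mem_part v hv
    by_cases h' : t ∈ M ∧ v ∈ C
    · exact ⟨Sum.inr t, ht, h'⟩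
    · exact ⟨Sum.inl t, ht, fun h1 h2 => h' ⟨h1, h2⟩⟩
  exists_adj_mem_part := by
    intro v hv w hvw
    obtain ⟨t, ht, ht'⟩ := D.exists_adj_mem_part v hv w hvw
    by_cases hM : t ∈ M
    · by_cases hvC : v ∈ C
      · exact ⟨Sum.inr t, ⟨ht, hM, hvC⟩, ⟨ht', hM, hcl v hvC w ⟨t, hM, ht'⟩ hvw⟩⟩
      · exact ⟨Sum.inl t, ⟨ht, fun _ => hvC⟩,
          ⟨ht', fun _ hwC => hvC (hcl w hwC v ⟨t, hM, ht⟩ hvw.symm)⟩⟩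
    · exact ⟨Sum.inl t, ⟨ht, fun h' => absurd h' hM⟩, ⟨ht', fun h' => absurd h' hM⟩⟩
  exists_walk := by
    intro v t₁ t₂ h₁ h₂
    by_cases hv : v ∈ C
    -- The nodes containing a vertex of `C` form the image under `toSum` of the old ones, so walks
    -- can be mapped; a vertex outside `C` occurs in the first copy only.
    · have aux : ∀ t : ι ⊕ ι, v ∈ Sum.elim (fun t => {v ∈ D.part t | t ∈ M → v ∉ C})
          (fun t => {v ∈ D.part t | t ∈ M ∧ v ∈ C}) t →
          ∃ u, v ∈ D.part u ∧ h.toSum u = t := by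
        rintro (t | t) ht
        · exact ⟨t, ht.1, h.toSum_of_notMem fun h' => ht.2 h' hv⟩
        · exact ⟨t, ht.1, h.toSum_of_mem ht.2.1⟩
      obtain ⟨u₁, hu₁, rfl⟩ := aux t₁ h₁
      obtain ⟨u₂, hu₂, rfl⟩ := aux t₂ h₂
      obtain ⟨p, hp⟩ := D.exists_walk v u₁ u₂ hu₁ hu₂
      refine ⟨p.map h.toSum, ?_⟩
      intro t ht
      rw [Walk.support_map, List.mem_map] at ht
      obtain ⟨u, hu, rfl⟩ := ht
      by_cases hM : u ∈ M
      · rw [h.toSum_of_mem hM]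
        exact ⟨hp u hu, hM, hv⟩
      · rw [h.toSum_of_notMem hM]
        exact ⟨hp u hu, fun h' => absurd h' hM⟩
    · rcases t₁ with t₁ | t₁
      swap
      · exact absurd h₁.2.2 hv
      rcases t₂ with t₂ | t₂
      swap
      · exact absurd h₂.2.2 hv
      obtain ⟨p, hp⟩ := D.exists_walk v t₁ t₂ h₁.1 h₂.1
      obtain ⟨q, hq⟩ := p.exists_sum_sup_edge_inl D.tree s r
      refine ⟨q, fun t ht => ?_⟩
      obtain ⟨u, hu, rfl⟩ := hq t ht
      exact ⟨hp u hu, fun _ => hv⟩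

/-- Joining tree-decompositions of two disjoint sets. -/
def join {ι' : Type} {K' : Set V} [Finite ι] [Finite ι'] (D : SetTreeDecomposition G K ι)
    (D' : SetTreeDecomposition G K' ι') (hK : Disjoint K K') (s : ι) (r : ι') :
    SetTreeDecomposition G (K ∪ K') (ι ⊕ ι') where
  tree := (D.tree ⊕g D'.tree) ⊔ edge (Sum.inl s) (Sum.inr r)
  isTree := D.isTree.sum_sup_edge D'.isTree s r
  part := Sum.elim D.part D'.part
  part_subset := by
    rintro (t | t) v hv
    exacts [Or.inl (D.part_subset t hv), Or.inr (D'.part_subset t hv)]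
  exists_mem_part := by
    rintro v (hv | hv)
    · obtain ⟨t, ht⟩ := D.exists_mem_part v hv
      exact ⟨Sum.inl t, ht⟩
    · obtain ⟨t, ht⟩ := D'.exists_mem_part v hv
      exact ⟨Sum.inr t, ht⟩
  exists_adj_mem_part := by
    rintro v (hv | hv) w hvw
    · obtain ⟨t, ht⟩ := D.exists_adj_mem_part v hv w hvw
      exact ⟨Sum.inl t, ht⟩
    · obtain ⟨t, ht⟩ := D'.exists_adj_mem_part v hv w hvw
      exact ⟨Sum.inr t, ht⟩
  exists_walk := by
    rintro v (t₁ | t₁) (t₂ | t₂) h₁ h₂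
    · obtain ⟨p, hp⟩ := D.exists_walk v t₁ t₂ h₁ h₂
      obtain ⟨q, hq⟩ := p.exists_sum_sup_edge_inl D'.tree s r
      refine ⟨q, fun t ht => ?_⟩
      obtain ⟨u, hu, rfl⟩ := hq t ht
      exact hp u hu
    · exact absurd (D'.part_subset _ h₂) (Set.disjoint_left.1 hK (D.part_subset _ h₁))
    · exact absurd (D'.part_subset _ h₁) (Set.disjoint_left.1 hK (D.part_subset _ h₂))
    · obtain ⟨p, hp⟩ := D'.exists_walk v t₁ t₂ h₁ h₂
      obtain ⟨q, hq⟩ := p.exists_sum_sup_edge_inr D.tree s r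
      refine ⟨q, fun t ht => ?_⟩
      obtain ⟨u, hu, rfl⟩ := hq t ht
      exact hp u hu

/-- The sum of the squares of the sizes of the parts. -/
noncomputable def energy (D : SetTreeDecomposition G K ι) : ℕ := ∑ᶠ t, (D.part t).ncard ^ 2

/-- Each part is divided between the two copies, and a² + b² ≤ (a + b)², strictly when both terms
are positive. This happens at `r`. -/
theorem energy_split_lt [Finite V] [Finite ι] (D : SetTreeDecomposition G K ι) {M : Set ι}
    {s r : ι} (h : D.IsSide M s r) (C : Set V)
    (hcl : ∀ a ∈ C, ∀ b ∈ D.region M, G.Adj a b → b ∈ C)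
    (h₁ : ∃ v ∈ C, v ∈ D.part r) (h₂ : ∃ v ∉ C, v ∈ D.part r) :
    (D.split h C hcl).energy < D.energy := by
  have := Fintype.ofFinite ι
  unfold energy
  rw [finsum_eq_sum_of_fintype, finsum_eq_sum_of_fintype, Fintype.sum_sum_type,
    ← Finset.sum_add_distrib]
  have hcard : ∀ t, ((D.split h C hcl).part (Sum.inl t)).ncard +
      ((D.split h C hcl).part (Sum.inr t)).ncard = (D.part t).ncard := by
    intro t
    rw [← Set.ncard_union_eq]
    · congr 1
      ext v
      by_cases h1 : t ∈ M <;> by_cases h2 : v ∈ C <;> simp [split, h1, h2]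
    · rw [Set.disjoint_left]
      rintro v hv hv'
      exact hv.2 hv'.2.1 hv'.2.2
  refine Finset.sum_lt_sum ?_ ⟨r, Finset.mem_univ _, ?_⟩
  · intro t _
    rw [← hcard t, add_sq]
    omega
  · rw [← hcard r]
    have p1 : 0 < ((D.split h C hcl).part (Sum.inl r)).ncard := by
      obtain ⟨v, hv, hv'⟩ := h₂
      exact (Set.ncard_pos (Set.toFinite _)).2 ⟨v, hv', fun _ => hv⟩
    have p2 : 0 < ((D.split h C hcl).part (Sum.inr r)).ncard := by
      obtain ⟨v, hv, hv'⟩ := h₁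
      exact (Set.ncard_pos (Set.toFinite _)).2 ⟨v, hv', h.right_mem, hv⟩
    nlinarith

theorem ncard_part_split_le [Finite V] [Finite ι] (D : SetTreeDecomposition G K ι) {M : Set ι}
    {s r : ι} (h : D.IsSide M s r) (C : Set V)
    (hcl : ∀ a ∈ C, ∀ b ∈ D.region M, G.Adj a b → b ∈ C) {n : ℕ}
    (hn : ∀ t, (D.part t).ncard ≤ n) (t : ι ⊕ ι) : ((D.split h C hcl).part t).ncard ≤ n := by
  rcases t with t | t <;>
  exact (Set.ncard_le_ncard (fun v hv => hv.1) (Set.toFinite _)).trans (hn t)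

/-- The nodes with non-empty parts are connected in the tree. -/
theorem exists_walk_nonempty (D : SetTreeDecomposition G K ι) (hK : G.ConnectedOn K)
    {t₁ t₂ : ι} (h₁ : (D.part t₁).Nonempty) (h₂ : (D.part t₂).Nonempty) :
    ∃ p : D.tree.Walk t₁ t₂, ∀ t ∈ p.support, (D.part t).Nonempty := by
  obtain ⟨v₁, hv₁⟩ := h₁
  obtain ⟨v₂, hv₂⟩ := h₂
  obtain ⟨p, hp⟩ := hK.exists_walk (D.part_subset _ hv₁) (D.part_subset _ hv₂)
  induction p generalizing t₁ with
  | nil =>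
    obtain ⟨q, hq⟩ := D.exists_walk _ _ _ hv₁ hv₂
    exact ⟨q, fun t ht => ⟨_, hq t ht⟩⟩
  | @cons x y z h p ih =>
    obtain ⟨t, hx, hy⟩ := D.exists_adj_mem_part x (hp x (by simp)) y h
    obtain ⟨q, hq⟩ := D.exists_walk _ _ _ hv₁ hx
    obtain ⟨q', hq'⟩ := ih hy hv₂ (fun x hx => hp x (by simp [hx]))
    refine ⟨q.append q', fun u hu => ?_⟩
    rcases (Walk.mem_support_append_iff _ _).1 hu with hu | hu
    exacts [⟨_, hq u hu⟩, hq' u hu]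

/-- The restriction to the nodes with non-empty parts. -/
def prune (D : SetTreeDecomposition G K ι) (hK : G.ConnectedOn K) (hne : K.Nonempty) :
    SetTreeDecomposition G K {t | (D.part t).Nonempty} where
  tree := D.tree.induce {t | (D.part t).Nonempty}
  isTree := by
    refine ⟨?_, D.isTree.isAcyclic.induce _⟩
    obtain ⟨v, hv⟩ := hne
    obtain ⟨t, ht⟩ := D.exists_mem_part v hv
    have : Nonempty {t | (D.part t).Nonempty} := ⟨t, v, ht⟩
    refine ⟨fun t₁ t₂ => ?_⟩
    obtain ⟨p, hp⟩ := D.exists_walk_nonempty hK t₁.2 t₂.2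
    exact ⟨p.induce _ hp⟩
  part := fun t => D.part t
  part_subset := fun t => D.part_subset t
  exists_mem_part := by
    intro v hv
    obtain ⟨t, ht⟩ := D.exists_mem_part v hv
    exact ⟨⟨t, v, ht⟩, ht⟩
  exists_adj_mem_part := by
    intro v hv w hvw
    obtain ⟨t, ht⟩ := D.exists_adj_mem_part v hv w hvw
    exact ⟨⟨t, v, ht.1⟩, ht⟩
  exists_walk := by
    intro v t₁ t₂ h₁ h₂
    obtain ⟨p, hp⟩ := D.exists_walk v t₁ t₂ h₁ h₂
    have hp' : ∀ t ∈ p.support, t ∈ {t | (D.part t).Nonempty} := fun t ht => ⟨v, hp t ht⟩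
    refine ⟨p.induce _ hp', ?_⟩
    intro t ht
    rw [Walk.support_induce] at ht
    simp only [List.mem_attachWith] at ht
    exact hp t ht

theorem energy_prune [Finite ι] (D : SetTreeDecomposition G K ι) (hK : G.ConnectedOn K)
    (hne : K.Nonempty) : (D.prune hK hne).energy ≤ D.energy := by
  have := Fintype.ofFinite ι
  have := Fintype.ofFinite {t | (D.part t).Nonempty}
  unfold energy
  rw [finsum_eq_sum_of_fintype, finsum_eq_sum_of_fintype]
  refine le_trans (le_of_eq ?_) (Finset.sum_le_sum_of_subset (Finset.subset_univ
    (Finset.univ.map (Function.Embedding.subtype (· ∈ {t | (D.part t).Nonempty})))))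
  rw [Finset.sum_map]
  rfl

/-- All sides of the edges of the tree are connected. -/
def SidesConnected (D : SetTreeDecomposition G K ι) : Prop :=
  ∀ M s r, D.IsSide M s r → G.ConnectedOn (D.region M)

/-- A connected set with a tree-decomposition has one with parts that are not larger, with
non-empty parts, and with connected sides. -/
theorem exists_sidesConnected [Finite V] [Finite ι] (D : SetTreeDecomposition G K ι)
    (hK : G.ConnectedOn K) (hne : K.Nonempty) {n : ℕ} (hn : ∀ t, (D.part t).ncard ≤ n) :
    ∃ (κ : Type) (_ : Finite κ) (D' : SetTreeDecomposition G K κ),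
      D'.SidesConnected ∧ (∀ t, (D'.part t).Nonempty) ∧ ∀ t, (D'.part t).ncard ≤ n := by
  classical
  -- Empty parts are admitted among the competitors, since splitting creates them; pruning a minimal
  -- competitor does not raise its energy.
  let P : ℕ → Prop := fun e => ∃ (κ : Type) (_ : Finite κ) (D' : SetTreeDecomposition G K κ),
    (∀ t, (D'.part t).ncard ≤ n) ∧ D'.energy = e
  have hP : ∃ e, P e := ⟨_, ι, ‹_›, D, hn, rfl⟩
  obtain ⟨κ, hκ, D₁, hD₁, he⟩ := Nat.find_spec hP
  refine ⟨_, Subtype.finite, D₁.prune hK hne, ?_, fun t => t.2, fun t => hD₁ t⟩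
  intro M s r h C hC hCne hcl
  by_contra hCM
  obtain ⟨b, hb, hbC⟩ : ∃ b ∈ D₁.prune hK hne |>.region M, b ∉ C := by
    by_contra! hcon
    exact hCM (hC.antisymm hcon)
  have h₁ := h.exists_mem_part_of_closed hK hC hCne hcl hCM
  -- The rest of the region is closed under adjacency too, so both halves meet the part at `r`, as
  -- the strict decrease requires.
  obtain ⟨v, hv, hvr⟩ := h.exists_mem_part_of_closed hK
    (C := (D₁.prune hK hne).region M \ C) Set.sdiff_subset ⟨b, hb, hbC⟩
    (fun x hx y hy hxy => ⟨hy, fun hyC => hx.2 (hcl y hyC x hx.1 hxy.symm)⟩) (by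
      intro h
      obtain ⟨c, hc⟩ := hCne
      have := hC hc
      rw [← h] at this
      exact this.2 hc)
  have hlt := (D₁.prune hK hne).energy_split_lt h C hcl h₁ ⟨v, hv.2, hvr⟩
  have hle := D₁.energy_prune hK hne
  refine Nat.find_min hP (m := ((D₁.prune hK hne).split h C hcl).energy) (by omega)
    ⟨_, inferInstance, _, ?_, rfl⟩
  exact ncard_part_split_le _ h C hcl fun t => hD₁ t

end SetTreeDecomposition

/-! ### Rooted trees -/

section RootedTree

variable {ι : Type*} {T : SimpleGraph ι}

/-- The list of nodes on the path from the root `ρ` to `u`. -/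
noncomputable def IsTree.trace (hT : T.IsTree) (ρ u : ι) : List ι :=
  (hT.existsUnique_path ρ u).choose.support

variable (hT : T.IsTree) {ρ : ι}

theorem IsTree.eq_of_isPath (hT : T.IsTree) {u v : ι} {p q : T.Walk u v} (hp : p.IsPath) (hq : q.IsPath) : p = q :=
  (hT.existsUnique_path u v).unique hp hq

theorem IsTree.exists_isPath_trace (ρ u : ι) :
    ∃ p : T.Walk ρ u, p.IsPath ∧ p.support = hT.trace ρ u :=
  ⟨_, (hT.existsUnique_path ρ u).choose_spec.1, rfl⟩

theorem IsTree.support_eq_trace {u : ι} {p : T.Walk ρ u} (hp : p.IsPath) :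
    p.support = hT.trace ρ u := by
  obtain ⟨q, hq, h⟩ := hT.exists_isPath_trace ρ u
  rw [← h, hT.eq_of_isPath hp hq]

theorem IsTree.trace_self : hT.trace ρ ρ = [ρ] :=
  (hT.support_eq_trace (p := (Walk.nil : T.Walk ρ ρ)) Walk.IsPath.nil).symm

theorem IsTree.nodup_trace (ρ u : ι) : (hT.trace ρ u).Nodup := by
  obtain ⟨q, hq, h⟩ := hT.exists_isPath_trace ρ u
  exact h ▸ hq.support_nodup

theorem IsTree.self_mem_trace (ρ u : ι) : u ∈ hT.trace ρ u := by
  obtain ⟨q, -, h⟩ := hT.exists_isPath_trace ρ u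
  exact h ▸ q.end_mem_support

theorem IsTree.root_mem_trace (ρ u : ι) : ρ ∈ hT.trace ρ u := by
  obtain ⟨q, -, h⟩ := hT.exists_isPath_trace ρ u
  exact h ▸ q.start_mem_support

theorem IsTree.getLast?_trace (ρ u : ι) : (hT.trace ρ u).getLast? = some u := by
  obtain ⟨q, -, h⟩ := hT.exists_isPath_trace ρ u
  rw [← h, List.getLast?_eq_some_getLast q.support_ne_nil, Walk.getLast_support]

theorem IsTree.trace_injective {u v : ι} (h : hT.trace ρ u = hT.trace ρ v) : u = v := by
  have h₁ := hT.getLast?_trace ρ u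
  rw [h, hT.getLast?_trace ρ v] at h₁
  exact (Option.some_injective _ h₁).symm

/-- This turns the tree order into the prefix order on traces, whose antisymmetry comes from
comparing lengths. -/
theorem IsTree.trace_prefix {r u : ι} (h : r ∈ hT.trace ρ u) :
    hT.trace ρ r <+: hT.trace ρ u := by
  classical
  obtain ⟨q, hq, hqu⟩ := hT.exists_isPath_trace ρ u
  rw [← hqu] at h ⊢
  rw [← hT.support_eq_trace (hq.takeUntil h)]
  conv_rhs => rw [← q.take_spec h, Walk.support_append]
  exact List.prefix_append _ _

/-- `t` is the parent of `r`. -/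
def IsTree.IsParent (hT : T.IsTree) (ρ t r : ι) : Prop := hT.trace ρ r = hT.trace ρ t ++ [r]

/-- If `r` is not on the path to `t`, the edge extends that path. If each node were on the path to
the other, the two traces would be prefixes of each other and the nodes equal. -/
theorem IsTree.isParent_or_isParent {t r : ι} (h : T.Adj t r) :
    hT.IsParent ρ t r ∨ hT.IsParent ρ r t := by
  have key : ∀ {t r : ι}, T.Adj t r → r ∉ hT.trace ρ t → hT.IsParent ρ t r := by
    intro t r h hr
    obtain ⟨q, hq, hqu⟩ := hT.exists_isPath_trace ρ t
    rw [← hqu] at hr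
    have := hT.support_eq_trace (hq.concat hr h)
    rw [Walk.support_concat] at this
    simpa [IsParent, ← hqu] using this.symm
  by_cases hr : r ∈ hT.trace ρ t
  · right
    refine key h.symm fun ht => h.ne (hT.trace_injective (ρ := ρ) ?_)
    have h₁ := hT.trace_prefix hr
    have h₂ := hT.trace_prefix ht
    exact h₂.eq_of_length (le_antisymm h₂.length_le h₁.length_le)
  · exact Or.inl (key h hr)

theorem IsTree.exists_isParent {u : ι} (hu : u ≠ ρ) : ∃ t, T.Adj t u ∧ hT.IsParent ρ t u := by
  obtain ⟨q, hq, hqu⟩ := hT.exists_isPath_trace ρ u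
  have hq' := hq.reverse
  have hqs : q.support = q.reverse.support.reverse := by simp
  generalize q.reverse = q' at hq' hqs
  cases q' with
  | nil => exact absurd rfl hu
  | @cons _ t _ h p =>
    refine ⟨t, h.symm, ?_⟩
    rw [IsParent, ← hqu, hqs, ← hT.support_eq_trace hq'.of_cons.reverse]
    simp

theorem IsTree.IsParent.adj {hT : T.IsTree} {t r : ι} (h : hT.IsParent ρ t r) : T.Adj t r := by
  have hr : r ≠ ρ := by
    rintro rfl
    have h₁ : hT.trace r r = hT.trace r t ++ [r] := h
    rw [hT.trace_self, List.self_eq_append_left] at h₁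
    have := hT.self_mem_trace r t
    simp [h₁] at this
  obtain ⟨t', h', hp⟩ := hT.exists_isParent hr
  rw [IsParent, h] at hp
  rw [hT.trace_injective (List.append_left_injective _ hp)]
  exact h'

/-- The nodes below `r`. -/
def IsTree.below (hT : T.IsTree) (ρ r : ι) : Set ι := {u | r ∈ hT.trace ρ u}

theorem IsTree.self_mem_below (ρ r : ι) : r ∈ hT.below ρ r := hT.self_mem_trace ρ r

theorem IsTree.below_subset {r s : ι} (h : r ∈ hT.below ρ s) : hT.below ρ r ⊆ hT.below ρ s :=
  fun _ hu => (hT.trace_prefix hu).subset h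

theorem IsTree.IsParent.mem_below {hT : T.IsTree} {t r : ι} (h : hT.IsParent ρ t r) :
    r ∈ hT.below ρ t := by
  change t ∈ hT.trace ρ r
  rw [h]
  simp [hT.self_mem_trace]

theorem IsTree.IsParent.notMem_below {hT : T.IsTree} {t r : ι} (h : hT.IsParent ρ t r) :
    t ∉ hT.below ρ r := by
  intro h'
  have h₁ := (hT.trace_prefix h').length_le
  rw [h] at h₁
  simp at h₁

/-- The required child is the entry following `t` in the trace of `u`. Its own trace is comparable
with the prefix ending there, and they agree because no node repeats. -/
theorem IsTree.exists_isParent_mem_below {t u : ι} (hu : u ∈ hT.below ρ t) (hne : u ≠ t) :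
    ∃ r, hT.IsParent ρ t r ∧ u ∈ hT.below ρ r := by
  obtain ⟨l, hl⟩ := hT.trace_prefix hu
  cases l with
  | nil =>
    rw [List.append_nil] at hl
    exact absurd (hT.trace_injective hl).symm hne
  | cons r l =>
    have hr : r ∈ hT.trace ρ u := by simp [← hl]
    refine ⟨r, ?_, hr⟩
    have hpre : hT.trace ρ t ++ [r] <+: hT.trace ρ u := ⟨l, by simp [← hl]⟩
    have hpre' := hT.trace_prefix hr
    have hnd := hT.nodup_trace ρ u
    rcases List.prefix_or_prefix_of_prefix hpre hpre' with h | h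
    · obtain ⟨l', hl'⟩ := h
      have hlast := hT.getLast?_trace ρ r
      rcases List.eq_nil_or_concat l' with rfl | ⟨l'', x, rfl⟩
      · rw [IsParent, ← hl', List.append_nil]
      · exfalso
        rw [← hl'] at hlast
        simp only [List.concat_eq_append, ← List.append_assoc, List.getLast?_append,
          List.getLast?_singleton, Option.some_or, Option.some_inj] at hlast
        have := hT.nodup_trace ρ r
        rw [← hl', hlast] at this
        simp [List.nodup_append] at this
    · rw [List.prefix_concat_iff] at h
      rcases h with h | h
      · exact h
      · exfalso
        have h₁ := h.subset (hT.self_mem_trace ρ r)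
        rw [← hl] at hnd
        simp only [List.nodup_append] at hnd
        exact hnd.2.2 r h₁ r (by simp) rfl

theorem IsTree.rooted_induction {P : ι → Prop} (ρ : ι) (h₀ : P ρ)
    (h : ∀ t r, hT.IsParent ρ t r → P t → P r) (u : ι) : P u := by
  obtain ⟨n, hn⟩ : ∃ n, n = (hT.trace ρ u).length := ⟨_, rfl⟩
  induction n generalizing u with
  | zero =>
    have := hT.self_mem_trace ρ u
    rw [List.length_eq_zero_iff.1 hn.symm] at this
    simp at this
  | succ n ih =>
    by_cases hu : u = ρ
    · exact hu ▸ h₀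
    · obtain ⟨t, -, ht⟩ := hT.exists_isParent hu
      refine h t u ht (ih t ?_)
      have : (hT.trace ρ u).length = (hT.trace ρ t).length + 1 := by rw [ht]; simp
      omega

/-- Recursive choice down a rooted tree. -/
theorem IsTree.exists_rooted_choice {β : Type*} (ρ : ι) (P : ι → β → Prop)
    (R : ι → ι → β → β → Prop) (h₀ : ∃ x, P ρ x)
    (h : ∀ t r, hT.IsParent ρ t r → ∀ x, P t x → ∃ y, P r y ∧ R t r x y) :
    ∃ f : ι → β, (∀ u, P u (f u)) ∧ ∀ t r, hT.IsParent ρ t r → R t r (f t) (f r) := by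
  classical
  obtain ⟨x₀, hx₀⟩ := h₀
  -- Folding `step` along the trace makes the value at a node depend only on that node and its
  -- parent's value. The default `x₀` is what the root receives, having no parent.
  let step : ι → β → β := fun r x =>
    if h' : ∃ y t, hT.IsParent ρ t r ∧ P r y ∧ R t r x y then h'.choose else x₀
  let f : ι → β := fun u => (hT.trace ρ u).foldl (fun x r => step r x) x₀
  have hf : ∀ t r, hT.IsParent ρ t r → P t (f t) → P r (f r) ∧ R t r (f t) (f r) := by
    intro t r htr ht
    obtain ⟨y, hy⟩ := h t r htr _ ht
    have h' : ∃ y t', hT.IsParent ρ t' r ∧ P r y ∧ R t' r (f t) y := ⟨y, t, htr, hy⟩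
    have hfr : f r = step r (f t) := by
      simp only [f]
      rw [htr, List.foldl_append]
      rfl
    obtain ⟨t', ht', hP, hR⟩ := h'.choose_spec
    obtain rfl : t = t' := by
      rw [IsParent, htr] at ht'
      exact hT.trace_injective (List.append_left_injective _ ht')
    rw [hfr]
    simp only [step]
    rw [dif_pos h']
    exact ⟨hP, hR⟩
  have hroot : f ρ = x₀ := by
    simp only [f]
    rw [hT.trace_self]
    simp only [List.foldl_cons, List.foldl_nil, step]
    rw [dif_neg]
    rintro ⟨y, t, ht, -⟩
    exact ht.notMem_below (hT.root_mem_trace ρ t)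
  have hP : ∀ u, P u (f u) :=
    hT.rooted_induction ρ (hroot ▸ hx₀) fun t r htr ht => (hf t r htr ht).1
  exact ⟨f, hP, fun t r htr => (hf t r htr (hP t)).2⟩

end RootedTree

/-! ### Cones of a rooted tree-decomposition -/

namespace SetTreeDecomposition

variable {V : Type*} {G : SimpleGraph V} {K : Set V} {ι : Type}

theorem isSide_below (D : SetTreeDecomposition G K ι) {ρ t r : ι}
    (h : D.isTree.IsParent ρ t r) : D.IsSide (D.isTree.below ρ r) t r where
  adj := h.adj
  left_notMem := h.notMem_below
  right_mem := D.isTree.self_mem_below ρ r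
  eq_of_adj := by
    intro y z hyz hy hz
    rcases D.isTree.isParent_or_isParent (ρ := ρ) hyz with h' | h'
    · change r ∈ D.isTree.trace ρ z at hz
      rw [h'] at hz
      simp only [List.mem_append, List.mem_singleton] at hz
      rcases hz with hz | rfl
      · exact absurd hz hy
      · rw [IsTree.IsParent, h] at h'
        exact ⟨(D.isTree.trace_injective (List.append_left_injective _ h')).symm, rfl⟩
    · exact absurd (D.isTree.below_subset hz h'.mem_below) hy

/-- The union of the parts at the nodes below `r`. -/
def cone (D : SetTreeDecomposition G K ι) (ρ r : ι) : Set V := D.region (D.isTree.below ρ r)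

theorem part_subset_cone (D : SetTreeDecomposition G K ι) (ρ r : ι) : D.part r ⊆ D.cone ρ r :=
  fun _ hv => ⟨r, D.isTree.self_mem_below ρ r, hv⟩

theorem cone_root (D : SetTreeDecomposition G K ι) (ρ : ι) : D.cone ρ ρ = K := by
  refine (D.region_subset _).antisymm fun v hv => ?_
  obtain ⟨t, ht⟩ := D.exists_mem_part v hv
  exact ⟨t, D.isTree.root_mem_trace ρ t, ht⟩

theorem cone_subset (D : SetTreeDecomposition G K ι) {ρ r s : ι} (h : r ∈ D.isTree.below ρ s) :
    D.cone ρ r ⊆ D.cone ρ s := by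
  rintro v ⟨t, ht, hv⟩
  exact ⟨t, D.isTree.below_subset h ht, hv⟩

theorem connectedOn_cone (D : SetTreeDecomposition G K ι) (hD : D.SidesConnected)
    (hK : G.ConnectedOn K) (ρ r : ι) : G.ConnectedOn (D.cone ρ r) := by
  by_cases h : r = ρ
  · subst h
    rwa [D.cone_root]
  · obtain ⟨t, -, ht⟩ := D.isTree.exists_isParent h
    exact hD _ _ _ (D.isSide_below ht)

theorem mem_part_of_mem_cone (D : SetTreeDecomposition G K ι) {ρ r t : ι} {v : V}
    (ht : t ∉ D.isTree.below ρ r) (hv : v ∈ D.part t) (hvr : v ∈ D.cone ρ r) : v ∈ D.part r := by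
  obtain ⟨u, hu, hvu⟩ := hvr
  have hr : r ≠ ρ := by
    rintro rfl
    exact ht (D.isTree.root_mem_trace r t)
  obtain ⟨s, -, hs⟩ := D.isTree.exists_isParent hr
  exact ((D.isSide_below hs).mem_part ht hu hv hvu).2

theorem mem_cone_of_adj (D : SetTreeDecomposition G K ι) {ρ r : ι} {v w : V}
    (hv : v ∈ D.cone ρ r) (hv' : v ∉ D.part r) (hvw : G.Adj v w) : w ∈ D.cone ρ r := by
  obtain ⟨u, hu, hvu⟩ := hv
  obtain ⟨t, hvt, hwt⟩ := D.exists_adj_mem_part v (D.part_subset u hvu) w hvw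
  by_cases ht : t ∈ D.isTree.below ρ r
  · exact ⟨t, ht, hwt⟩
  · exact absurd (D.mem_part_of_mem_cone ht hvt ⟨u, hu, hvu⟩) hv'

/-- A part meets the cone of a node below it only in the part at that node. -/
theorem part_inter_cone_subset (D : SetTreeDecomposition G K ι) {ρ r s : ι}
    (h : r ∈ D.isTree.below ρ s) : D.part s ∩ D.cone ρ r ⊆ D.part r := by
  rintro v ⟨hv, hv'⟩
  by_cases hs : s ∈ D.isTree.below ρ r
  · have h₁ := D.isTree.trace_prefix h
    have h₂ := D.isTree.trace_prefix hs
    rw [← D.isTree.trace_injective (h₁.eq_of_length (le_antisymm h₁.length_le h₂.length_le))]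
    exact hv
  · exact D.mem_part_of_mem_cone hs hv hv'

end SetTreeDecomposition

/-! ### Cuts and the cycle space -/

section Parity

variable {V : Type*} {G : SimpleGraph V}

open Classical in
/-- The characteristic function of a set with values in `𝔽₂`. -/
noncomputable def charTwo (S : Set V) (x : V) : ZMod 2 := if x ∈ S then 1 else 0

theorem charTwo_of_mem {S : Set V} {x : V} (h : x ∈ S) : charTwo S x = 1 := if_pos h

theorem charTwo_of_notMem {S : Set V} {x : V} (h : x ∉ S) : charTwo S x = 0 := if_neg h

/-- The characteristic function of the cut between `S` and its complement. -/
noncomputable def cutTwo (S : Set V) : Sym2 V → ZMod 2 :=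
  Sym2.lift ⟨fun x y => charTwo S x + charTwo S y, fun _ _ => add_comm _ _⟩

/-- The characteristic function of the set of pairs between disjoint sets `A` and `D`. -/
noncomputable def betweenTwo (A D : Set V) : Sym2 V → ZMod 2 :=
  Sym2.lift ⟨fun x y => charTwo A x * charTwo D y + charTwo D x * charTwo A y,
    fun _ _ => by ring⟩

/-- The sum telescopes modulo 2; in particular closed walks cross every cut evenly. -/
theorem Walk.sum_cutTwo_edges (S : Set V) {u v : V} (p : G.Walk u v) :
    (p.edges.map (cutTwo S)).sum = charTwo S u + charTwo S v := by
  induction p with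
  | nil => simp [CharTwo.add_self_eq_zero]
  | @cons x y z h p ih =>
    rw [Walk.edges_cons, List.map_cons, List.sum_cons, ih]
    change charTwo S x + charTwo S y + _ = _
    linear_combination CharTwo.add_self_eq_zero (charTwo S y)

theorem Walk.IsTrail.sum_edgeVector_mul [Fintype V] {u v : V} {p : G.Walk u v} (hp : p.IsTrail)
    (f : Sym2 V → ZMod 2) : ∑ e, p.edgeVector e * f e = (p.edges.map f).sum := by
  classical
  rw [← List.sum_toFinset f hp.edges_nodup]
  simp [Walk.edgeVector, ← List.mem_toFinset, Finset.sum_ite_mem]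

/-- A function summing to zero over the short cycles sums to zero over all cycles. -/
theorem CyclesGenerate.sum_edges_eq_zero [Finite V] {l : ℕ} (hl : G.CyclesGenerate l)
    {f : Sym2 V → ZMod 2}
    (hf : ∀ (v : V) (c : G.Walk v v), c.IsCycle → c.length ≤ l → (c.edges.map f).sum = 0)
    {v : V} {c : G.Walk v v} (hc : c.IsCycle) : (c.edges.map f).sum = 0 := by
  have := Fintype.ofFinite V
  have key : ∀ x ∈ G.cycleSpace, ∑ e, x e * f e = 0 := by
    rw [← hl]
    intro x hx
    induction hx using Submodule.span_induction with
    | mem x hx =>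
      obtain ⟨w, d, hd, hdl, rfl⟩ := hx
      rw [hd.isTrail.sum_edgeVector_mul, hf w d hd hdl]
    | zero => simp
    | add x y _ _ hx hy => simp [add_mul, Finset.sum_add_distrib, hx, hy]
    | smul a x _ hx => simp [mul_assoc, ← Finset.mul_sum, hx]
  rw [← hc.isTrail.sum_edgeVector_mul]
  exact key _ (Submodule.subset_span ⟨v, c, hc, rfl⟩)

/-- A path contained in a closed trail leaves out at least two of its edges, unless its end-vertices
are adjacent. -/
theorem Walk.IsTrail.adj_or_length_add_two_le {v a b : V} {c : G.Walk v v} (hc : c.IsTrail)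
    {q : G.Walk a b} (hq : q.IsPath) (hab : a ≠ b) (hqc : ∀ e ∈ q.edges, e ∈ c.edges) :
    G.Adj a b ∨ q.length + 2 ≤ c.length := by
  classical
  -- The closed trail crosses a cut evenly and `q` crosses one separating its ends oddly, so the
  -- leftover edges cross it oddly. For `{a}` and `{b}` this excludes an empty leftover and forces a
  -- single leftover edge to be `ab`.
  have hsum : ∀ S : Set V, charTwo S a + charTwo S b = 1 →
      ∑ e ∈ c.edges.toFinset \ q.edges.toFinset, cutTwo S e = 1 := by
    intro S hS
    have h₁ := Finset.sum_sdiff (f := cutTwo S)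
      (s₁ := q.edges.toFinset) (s₂ := c.edges.toFinset) (fun e he => by
        rw [List.mem_toFinset] at he ⊢
        exact hqc e he)
    rw [List.sum_toFinset _ hq.isTrail.edges_nodup, List.sum_toFinset _ hc.edges_nodup,
      Walk.sum_cutTwo_edges, Walk.sum_cutTwo_edges, CharTwo.add_self_eq_zero, hS] at h₁
    rw [eq_neg_of_add_eq_zero_left h₁]
    decide
  have hcard : (c.edges.toFinset \ q.edges.toFinset).card + q.length = c.length := by
    have h₁ := Finset.card_sdiff_add_card_eq_card
      (s := q.edges.toFinset) (t := c.edges.toFinset) (fun e he => by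
        rw [List.mem_toFinset] at he ⊢
        exact hqc e he)
    rwa [List.toFinset_card_of_nodup hq.isTrail.edges_nodup,
      List.toFinset_card_of_nodup hc.edges_nodup, Walk.length_edges, Walk.length_edges] at h₁
  have ha := hsum {a} (by simp [charTwo, hab.symm])
  have hb := hsum {b} (by simp [charTwo, hab])
  by_cases h2 : 2 ≤ (c.edges.toFinset \ q.edges.toFinset).card
  · right
    omega
  left
  have h1 : (c.edges.toFinset \ q.edges.toFinset).card = 1 := by
    by_contra h1
    have h0 : (c.edges.toFinset \ q.edges.toFinset).card = 0 := by omega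
    rw [Finset.card_eq_zero.1 h0] at ha
    simp at ha
  obtain ⟨e, he⟩ := Finset.card_eq_one.1 h1
  rw [he, Finset.sum_singleton] at ha hb
  have hec : e ∈ c.edges := by
    have : e ∈ c.edges.toFinset \ q.edges.toFinset := by simp [he]
    simp only [Finset.mem_sdiff, List.mem_toFinset] at this
    exact this.1
  have hmem : ∀ x, cutTwo {x} e = 1 → x ∈ e := by
    intro x hx
    induction e with
    | _ y z =>
      by_contra hcon
      rw [Sym2.mem_iff, not_or] at hcon
      have : cutTwo {x} s(y, z) = charTwo {x} y + charTwo {x} z := rfl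
      rw [this, charTwo_of_notMem fun h => hcon.1 h.symm,
        charTwo_of_notMem fun h => hcon.2 h.symm] at hx
      simp at hx
  have : e = s(a, b) := ((Sym2.mem_and_mem_iff hab).1 ⟨hmem a ha, hmem b hb⟩)
  rw [this] at hec
  exact c.adj_of_mem_edges hec

/-- If a cycle passes through `D` from `A` to `A'`, where the neighbourhood of `D` lies in `A ∪ A'`,
then there is a short walk from `A` to `A'` in `D` and its neighbourhood. -/
theorem CyclesGenerate.exists_walk_length_le [Finite V] {L : ℕ} (hgen : G.CyclesGenerate (L + 2))
    (hL : 1 ≤ L) {A A' D U : Set V} (hAD : Disjoint A D) (hA'D : Disjoint A' D)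
    (hAA' : Disjoint A A') (hUD : Disjoint U D)
    (hD : ∀ x ∈ D, ∀ y, G.Adj x y → y ∈ D ∨ y ∈ A ∨ y ∈ A')
    {a a' : V} (ha : a ∈ A) (ha' : a' ∈ A') (hnadj : ¬ G.Adj a a')
    (P : G.Walk a a') (hP : ∀ x ∈ P.support, x = a ∨ x = a' ∨ x ∈ D)
    (Q : G.Walk a' a) (hQ : ∀ x ∈ Q.support, x ∈ U) :
    ∃ b ∈ A, ∃ b' ∈ A', ∃ p : G.Walk b b', p.length ≤ L ∧
      ∀ x ∈ p.support, x ∈ A ∨ x ∈ A' ∨ x ∈ D := by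
  classical
  by_contra! hcon
  have hne : a ≠ a' := fun h => Set.disjoint_left.1 hAA' ha (h ▸ ha')
  have hshort : ∀ (v : V) (c : G.Walk v v), c.IsCycle → c.length ≤ L + 2 →
      (c.edges.map (betweenTwo A D)).sum = 0 := by
    intro v c hc hcl
    -- `S` consists of the vertices of `D` that edges of `c` reach from `A` within `A ∪ D`. Once no
    -- edge of `c` joins `S` to `A'`, the `A`–`D` edges of `c` are exactly its edges in the cut of
    -- `S`, an even number.
    let S : Set V := {d | d ∈ D ∧ ∃ b ∈ A, ∃ q : G.Walk b d, (∀ e ∈ q.edges, e ∈ c.edges) ∧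
      ∀ x ∈ q.support, x ∈ A ∨ x ∈ D}
    have hstep : ∀ x ∈ S, ∀ y ∈ D, s(x, y) ∈ c.edges → y ∈ S := by
      rintro x ⟨hx, b, hb, q, hq, hq'⟩ y hy hxy
      refine ⟨hy, b, hb, q.concat (c.adj_of_mem_edges hxy), ?_, ?_⟩
      · intro e he
        rw [Walk.edges_concat, List.concat_eq_append, List.mem_append, List.mem_singleton] at he
        rcases he with he | rfl
        exacts [hq e he, hxy]
      · intro z hz
        rw [Walk.support_concat] at hz
        simp only [List.mem_append, List.mem_singleton] at hz
        rcases hz with hz | rfl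
        exacts [hq' z hz, Or.inr hy]
    have hexit : ∀ x ∈ S, ∀ y ∈ A', s(x, y) ∉ c.edges := by
      rintro x ⟨hx, b, hb, q, hq, hq'⟩ y hy hxy
      have hby : b ≠ y := fun h => Set.disjoint_left.1 hAA' hb (h ▸ hy)
      let q₁ := (q.concat (c.adj_of_mem_edges hxy)).bypass
      have hq₁ : ∀ z ∈ q₁.support, z ∈ A ∨ z ∈ A' ∨ z ∈ D := by
        intro z hz
        have hz := Walk.support_bypass_subset_support _ hz
        rw [Walk.support_concat] at hz
        simp only [List.mem_append, List.mem_singleton] at hz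
        rcases hz with hz | rfl
        · rcases hq' z hz with h | h
          exacts [Or.inl h, Or.inr (Or.inr h)]
        · exact Or.inr (Or.inl hy)
      have hq₁e : ∀ e ∈ q₁.edges, e ∈ c.edges := by
        intro e he
        have he := Walk.edges_bypass_subset_edges _ he
        rw [Walk.edges_concat, List.concat_eq_append, List.mem_append, List.mem_singleton] at he
        rcases he with he | rfl
        exacts [hq e he, hxy]
      -- Either alternative yields a walk excluded by `hcon`: a single edge, as `1 ≤ L`, or `q₁`, as
      -- `c.length ≤ L + 2`.
      rcases hc.isTrail.adj_or_length_add_two_le (Walk.bypass_isPath _) hby hq₁e with h | h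
      · obtain ⟨z, hz, hz'⟩ := hcon b hb y hy h.toWalk (by simpa using hL)
        simp only [Walk.support_cons, Walk.support_nil, List.mem_cons, List.not_mem_nil,
          or_false] at hz
        rcases hz with rfl | rfl
        exacts [hz'.1 hb, hz'.2.1 hy]
      · obtain ⟨z, hz, hz'⟩ := hcon b hb y hy q₁ (by have : q₁.length + 2 ≤ c.length := h; omega)
        have := hq₁ z hz
        tauto
    have hentry : ∀ x ∈ D, ∀ y ∈ A, s(x, y) ∈ c.edges → x ∈ S := by
      intro x hx y hy hxy
      refine ⟨hx, y, hy, (c.adj_of_mem_edges hxy).symm.toWalk, ?_, ?_⟩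
      · simpa [Sym2.eq_swap] using hxy
      · simp [hx, hy]
    have hSD : ∀ x ∉ D, x ∉ S := fun x hx h => hx h.1
    have hout : ∀ x ∈ D, ∀ y ∉ D, s(x, y) ∈ c.edges →
        charTwo A y = charTwo S x := by
      intro x hx y hy hxy
      rcases hD x hx y (c.adj_of_mem_edges hxy) with h | h | h
      · exact absurd h hy
      · rw [charTwo_of_mem h, charTwo_of_mem (hentry x hx y h hxy)]
      · rw [charTwo_of_notMem fun h' => Set.disjoint_left.1 hAA' h' h,
          charTwo_of_notMem fun h' => hexit x h' y h hxy]
    have hcut : ∀ e ∈ c.edges, betweenTwo A D e = cutTwo S e := by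
      intro e he
      induction e with
      | _ x y =>
        change charTwo A x * charTwo D y + charTwo D x * charTwo A y = charTwo S x + charTwo S y
        by_cases hx : x ∈ D <;> by_cases hy : y ∈ D
        · rw [charTwo_of_notMem fun h => Set.disjoint_left.1 hAD h hx,
            charTwo_of_notMem fun h => Set.disjoint_left.1 hAD h hy]
          by_cases hxS : x ∈ S
          · rw [charTwo_of_mem hxS, charTwo_of_mem (hstep x hxS y hy he), zero_mul, mul_zero,
              add_zero, CharTwo.add_self_eq_zero]
          · rw [charTwo_of_notMem hxS, charTwo_of_notMem fun h =>
              hxS (hstep y h x hx (by rwa [Sym2.eq_swap]))]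
            simp
        · rw [charTwo_of_notMem hy, charTwo_of_mem hx, charTwo_of_notMem (hSD y hy),
            hout x hx y hy he]
          simp
        · rw [charTwo_of_notMem hx, charTwo_of_mem hy, charTwo_of_notMem (hSD x hx),
            hout y hy x hx (by rwa [Sym2.eq_swap])]
          simp
        · rw [charTwo_of_notMem hx, charTwo_of_notMem hy, charTwo_of_notMem (hSD x hx),
            charTwo_of_notMem (hSD y hy)]
          simp
    rw [List.map_congr_left hcut, Walk.sum_cutTwo_edges, CharTwo.add_self_eq_zero]
  have haD : a ∉ D := Set.disjoint_left.1 hAD ha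
  have ha'D : a' ∉ D := Set.disjoint_left.1 hA'D ha'
  have hP' : ∀ x ∈ P.bypass.support, x = a ∨ x = a' ∨ x ∈ D := fun x hx =>
    hP x (Walk.support_bypass_subset_support _ hx)
  have hQ' : ∀ x ∈ Q.bypass.support, x ∈ U := fun x hx =>
    hQ x (Walk.support_bypass_subset_support _ hx)
  have hPp := Walk.bypass_isPath P
  have hQp := Walk.bypass_isPath Q
  generalize P.bypass = P₁ at hP' hPp
  generalize Q.bypass = Q₁ at hQ' hQp
  -- The interior of `P₁` lies in `D`, which `Q₁` avoids, and `P₁` has at least two edges because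
  -- its ends are not adjacent.
  have hcyc : (P₁.append Q₁).IsCycle := by
    refine hPp.isCycle_append hQp ?_ ?_
    · intro x hxP hxQ
      rcases hP' x (List.mem_of_mem_tail hxP) with rfl | rfl | h
      · have := hPp.support_nodup
        rw [← Walk.cons_tail_support] at this
        exact (List.nodup_cons.1 this).1 hxP
      · have := hQp.support_nodup
        rw [← Walk.cons_tail_support] at this
        exact (List.nodup_cons.1 this).1 hxQ
      · exact Set.disjoint_left.1 hUD (hQ' x (List.mem_of_mem_tail hxQ)) h
    · left
      by_contra hlen
      have h0 : P₁.length ≠ 0 := fun h => hne (Walk.eq_of_length_eq_zero h)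
      exact hnadj (Walk.adj_of_length_eq_one (by omega : P₁.length = 1))
  have hz := hgen.sum_edges_eq_zero hshort hcyc
  rw [Walk.edges_append, List.map_append, List.sum_append] at hz
  have hQz : (Q₁.edges.map (betweenTwo A D)).sum = 0 := by
    refine List.sum_eq_zero fun z hz => ?_
    obtain ⟨e, he, rfl⟩ := List.mem_map.1 hz
    induction e with
    | _ x y =>
      change charTwo A x * charTwo D y + charTwo D x * charTwo A y = 0
      rw [charTwo_of_notMem (S := D) (Set.disjoint_left.1 hUD
        (hQ' x (Q₁.fst_mem_support_of_mem_edges he))), charTwo_of_notMem (S := D)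
        (Set.disjoint_left.1 hUD (hQ' y (Q₁.snd_mem_support_of_mem_edges he)))]
      simp
  rw [hQz, add_zero] at hz
  -- The first edge of `P₁` runs from `A` to `D`; its other edges avoid `A` and those of `Q₁` avoid
  -- `D`. The total is therefore 1, contradicting `hz`.
  cases P₁ with
  | nil => exact hne rfl
  | @cons _ x _ h P₂ =>
    rw [Walk.cons_isPath_iff] at hPp
    have hx : x ∈ D := by
      rcases hP' x (by simp) with h' | h' | h'
      · exact absurd h' h.ne'
      · exact absurd (h' ▸ h) hnadj
      · exact h'
    have hA : ∀ y ∈ P₂.support, y ∉ A := by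
      intro y hy hyA
      rcases hP' y (by simp [hy]) with h' | h' | h'
      · exact hPp.2 (h' ▸ hy)
      · exact Set.disjoint_left.1 hAA' hyA (h' ▸ ha')
      · exact Set.disjoint_left.1 hAD hyA h'
    have hP₂z : (P₂.edges.map (betweenTwo A D)).sum = 0 := by
      refine List.sum_eq_zero fun z hz => ?_
      obtain ⟨e, he, rfl⟩ := List.mem_map.1 hz
      induction e with
      | _ x y =>
        change charTwo A x * charTwo D y + charTwo D x * charTwo A y = 0
        rw [charTwo_of_notMem (hA x (P₂.fst_mem_support_of_mem_edges he)),
          charTwo_of_notMem (hA y (P₂.snd_mem_support_of_mem_edges he))]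
        simp
    rw [Walk.edges_cons, List.map_cons, List.sum_cons, hP₂z, add_zero] at hz
    change charTwo A a * charTwo D x + charTwo D a * charTwo A x = 0 at hz
    rw [charTwo_of_mem ha, charTwo_of_mem hx, charTwo_of_notMem haD] at hz
    simp at hz

end Parity

/-! ### Short walks between the halves of a part -/

namespace SetTreeDecomposition

variable {V : Type*} {G : SimpleGraph V} {K : Set V} {ι : Type}

/-- A path that starts inside a cone, but outside the part at the parent node, stays there until it
meets that part. -/
theorem support_subset_cone_of_isPath (D : SetTreeDecomposition G K ι) {ρ s r : ι}
    (hr : D.isTree.IsParent ρ s r) {x z : V} (q : G.Walk x z) (hq : q.IsPath)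
    (hx : x ∈ D.cone ρ r \ D.part s) (hqs : ∀ y ∈ q.support, y ∈ D.part s → y = z) :
    ∀ y ∈ q.support, y = z ∨ y ∈ D.cone ρ r \ D.part s := by
  induction q with
  | nil => simp
  | @cons x y z h q ih =>
    intro w hw
    rw [Walk.support_cons, List.mem_cons] at hw
    rcases hw with rfl | hw
    · exact Or.inr hx
    rw [Walk.cons_isPath_iff] at hq
    have hy : y ∈ D.cone ρ r :=
      (D.isSide_below hr).mem_region_of_adj hx.1 (fun h' => hx.2 h'.1) h
    by_cases hys : y ∈ D.part s
    · obtain rfl := hqs y (by simp) hys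
      left
      have := (Walk.isPath_iff_nil.1 hq.1).eq_nil
      simpa [this] using hw
    · exact ih hq.1 ⟨hy, hys⟩ (fun y hy => hqs y (by simp [hy])) w hw

/-- Any two complementary non-empty subsets of a part are joined by a short walk in the cone of that
part. -/
theorem exists_walk_cone_length_le [Finite V] (D : SetTreeDecomposition G K ι)
    (hD : D.SidesConnected) (hK : G.ConnectedOn K) {L : ℕ} (hgen : G.CyclesGenerate (L + 2))
    (hL : 1 ≤ L) (ρ s : ι) {A A' : Set V} (hA : A.Nonempty) (hA' : A'.Nonempty)
    (hAA' : Disjoint A A') (hun : A ∪ A' = D.part s) :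
    ∃ b ∈ A, ∃ b' ∈ A', ∃ p : G.Walk b b', p.length ≤ L ∧ ∀ x ∈ p.support, x ∈ D.cone ρ s := by
  classical
  have hAs : A ⊆ D.part s := hun ▸ Set.subset_union_left
  have hA's : A' ⊆ D.part s := hun ▸ Set.subset_union_right
  have hsc := D.part_subset_cone ρ s
  let P : ℕ → Prop := fun n => ∃ a ∈ A, ∃ a' ∈ A', ∃ p : G.Walk a a', p.length ≤ n ∧
    ∀ x ∈ p.support, x ∈ D.cone ρ s
  have hP : ∃ n, P n := by
    obtain ⟨a, ha⟩ := hA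
    obtain ⟨a', ha'⟩ := hA'
    obtain ⟨p, hp⟩ := (D.connectedOn_cone hD hK ρ s).exists_walk (hsc (hAs ha)) (hsc (hA's ha'))
    exact ⟨p.length, a, ha, a', ha', p, le_rfl, hp⟩
  obtain ⟨a, ha, a', ha', p₀, hp₀l, hp₀⟩ := Nat.find_spec hP
  obtain ⟨p, hpp, hpl, hp⟩ : ∃ p : G.Walk a a', p.IsPath ∧ p.length ≤ Nat.find hP ∧
      ∀ x ∈ p.support, x ∈ D.cone ρ s :=
    ⟨p₀.bypass, p₀.bypass_isPath, (p₀.length_bypass_le_length).trans hp₀l,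
      fun x hx => hp₀ x (p₀.support_bypass_subset_support hx)⟩
  by_cases hadj : G.Adj a a'
  · refine ⟨a, ha, a', ha', hadj.toWalk, by simpa using hL, ?_⟩
    simp [hsc (hAs ha), hsc (hA's ha')]
  -- By minimality: an inner vertex in `A` or `A'` would cut off a shorter walk between the two
  -- sets.
  have hint : ∀ x ∈ p.support, x ∈ D.part s → x = a ∨ x = a' := by
    intro x hx hxs
    by_contra! hcon
    have hlen := congrArg Walk.length (p.take_spec hx)
    rw [Walk.length_append] at hlen
    have h₁ : (p.takeUntil x hx).length ≠ 0 := fun h =>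
      hcon.1 (Walk.eq_of_length_eq_zero h).symm
    have h₂ : (p.dropUntil x hx).length ≠ 0 := fun h => hcon.2 (Walk.eq_of_length_eq_zero h)
    rw [← hun] at hxs
    rcases hxs with hxA | hxA
    · exact Nat.find_min hP (m := (p.dropUntil x hx).length) (by omega)
        ⟨x, hxA, a', ha', p.dropUntil x hx, le_rfl,
          fun y hy => hp y (p.support_dropUntil_subset_support hx hy)⟩
    · exact Nat.find_min hP (m := (p.takeUntil x hx).length) (by omega)
        ⟨a, ha, x, hxA, p.takeUntil x hx, le_rfl,
          fun y hy => hp y (p.support_takeUntil_subset_support hx hy)⟩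
  have hne : a ≠ a' := fun h => Set.disjoint_left.1 hAA' ha (h ▸ ha')
  cases p with
  | nil => exact absurd rfl hne
  | @cons _ x _ h q =>
    rw [Walk.cons_isPath_iff] at hpp
    have hxs : x ∉ D.part s := by
      intro hxs
      rcases hint x (by simp) hxs with h' | h'
      · exact h.ne' h'
      · exact hadj (h' ▸ h)
    obtain ⟨u, hu, hxu⟩ := hp x (by simp)
    obtain ⟨r, hr, hur⟩ := D.isTree.exists_isParent_mem_below hu (by
      rintro rfl
      exact hxs hxu)
    have hxD : x ∈ D.cone ρ r \ D.part s := ⟨⟨u, hur, hxu⟩, hxs⟩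
    have hq := D.support_subset_cone_of_isPath hr q hpp.1 hxD (by
      intro y hy hys
      rcases hint y (by simp [hy]) hys with rfl | h'
      · exact absurd hy hpp.2
      · exact h')
    have hside := D.isSide_below hr
    have hsr : s ∈ (D.isTree.below ρ r)ᶜ := hr.notMem_below
    -- The return path uses the complementary side, which is connected, contains the part at `s`,
    -- and meets the child's cone only inside that part.
    obtain ⟨Q, hQ⟩ := (hD _ _ _ hside.compl).exists_walk (a := a') (b := a)
      ⟨s, hsr, hA's ha'⟩ ⟨s, hsr, hAs ha⟩
    obtain ⟨b, hb, b', hb', w, hwl, hw⟩ := hgen.exists_walk_length_le hL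
      (A := A) (A' := A') (D := D.cone ρ r \ D.part s)
      (Set.disjoint_left.2 fun y hy hy' => hy'.2 (hAs hy))
      (Set.disjoint_left.2 fun y hy hy' => hy'.2 (hA's hy)) hAA'
      (U := D.region (D.isTree.below ρ r)ᶜ)
      (Set.disjoint_left.2 (by
        rintro y ⟨t, ht, hyt⟩ ⟨⟨v, hv, hyv⟩, hys⟩
        exact hys (hside.mem_part ht hv hyt hyv).1))
      (by
        intro y hy z hyz
        have hz : z ∈ D.cone ρ r := hside.mem_region_of_adj hy.1 (fun h' => hy.2 h'.1) hyz
        by_cases hzs : z ∈ D.part s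
        · rw [← hun] at hzs
          exact Or.inr hzs
        · exact Or.inl ⟨hz, hzs⟩)
      ha ha' hadj (Walk.cons h q) (by
        intro y hy
        rw [Walk.support_cons, List.mem_cons] at hy
        rcases hy with rfl | hy
        · exact Or.inl rfl
        · exact Or.inr (hq y hy)) Q hQ
    refine ⟨b, hb, b', hb', w, hwl, fun y hy => ?_⟩
    rcases hw y hy with h' | h' | h'
    exacts [hsc (hAs h'), hsc (hA's h'), D.cone_subset hr.mem_below h'.1]

end SetTreeDecomposition

/-! ### Extending forests by paths -/

section Forest

variable {V : Type*} {G F : SimpleGraph V}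

theorem Walk.eq_or_mem_support {x y : V} (p : F.Walk x y) {z : V} (hz : z ∈ p.support) :
    z = x ∨ z ∈ F.support := by
  induction p with
  | nil => exact Or.inl (by simpa using hz)
  | @cons x w y h p ih =>
    rw [Walk.support_cons, List.mem_cons] at hz
    rcases hz with rfl | hz
    · exact Or.inl rfl
    · rcases ih hz with rfl | h'
      exacts [Or.inr ⟨x, h.symm⟩, Or.inr h']

theorem Reachable.mem_support_of_ne {x y : V} (h : F.Reachable x y) (hne : x ≠ y) :
    y ∈ F.support := by
  obtain ⟨p⟩ := h
  exact (p.eq_or_mem_support p.end_mem_support).resolve_left hne.symm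

theorem Reachable.mem_of_closed {x y : V} (h : F.Reachable x y) {R : Set V} (hx : x ∈ R)
    (hR : ∀ u ∈ R, ∀ v, F.Adj u v → v ∈ R) : y ∈ R := by
  obtain ⟨p⟩ := h
  induction p with
  | nil => exact hx
  | cons h p ih => exact ih (hR _ hx _ h)

/-- Adding to a forest a path between different components whose inner vertices are new. -/
theorem IsAcyclic.sup_edges_of_isPath (hF : F.IsAcyclic) {x y : V} (p : G.Walk x y)
    (hp : p.IsPath) (hnr : ¬ F.Reachable x y)
    (hint : ∀ z ∈ p.support, z ∈ F.support → z = x ∨ z = y) :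
    (F ⊔ fromEdgeSet {e | e ∈ p.edges}).IsAcyclic := by
  induction p generalizing F with
  | nil => exact absurd (Reachable.refl _) hnr
  | @cons x z y h q ih =>
    rw [Walk.cons_isPath_iff] at hp
    have heq : F ⊔ fromEdgeSet {e | e ∈ (Walk.cons h q).edges} =
        (F ⊔ edge x z) ⊔ fromEdgeSet {e | e ∈ q.edges} := by
      rw [edge, sup_assoc, ← fromEdgeSet_union]
      congr 2
      ext e
      simp
    rw [heq]
    by_cases hzy : z = y
    · subst hzy
      have hq : q = Walk.nil := (Walk.isPath_iff_nil.1 hp.1).eq_nil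
      subst hq
      simpa using hF.sup_edge_of_not_reachable hnr
    · have hzF : z ∉ F.support := by
        intro hz
        rcases hint z (by simp) hz with h' | h'
        exacts [h.ne' h', hzy h']
      have hxz : ¬ F.Reachable x z := fun h' => hzF (h'.mem_support_of_ne h.ne)
      have hyz : ¬ F.Reachable y z := fun h' => hzF (h'.mem_support_of_ne (Ne.symm hzy))
      refine ih (hF.sup_edge_of_not_reachable hxz) hp.1 ?_ ?_
      · intro hr
        -- The component of `y` in `F` contains neither end of the new edge, so it stays closed
        -- after adding that edge.
        refine hyz (hr.symm.mem_of_closed (R := {u | F.Reachable y u}) (Reachable.refl y) ?_)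
        intro u hu v huv
        rcases huv with huv | huv
        · exact hu.trans huv.reachable
        · rw [edge_adj] at huv
          rcases huv.1 with ⟨rfl, rfl⟩ | ⟨rfl, rfl⟩
          exacts [absurd hu.symm hnr, absurd hu hyz]
      · rintro w hw ⟨v, hwv⟩
        rcases hwv with hwv | hwv
        · rcases hint w (by simp [hw]) ⟨v, hwv⟩ with rfl | h'
          exacts [absurd hw hp.2, Or.inr h']
        · rw [edge_adj] at hwv
          rcases hwv.1 with ⟨rfl, rfl⟩ | ⟨rfl, rfl⟩
          exacts [absurd hw hp.2, Or.inl rfl]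

open Classical in
-- Each visit to `I` is charged to the edge leaving it. If the walk also starts outside `I`, the
-- first edge entering `I` is extra; this second clause is the one used later, the first carries the
-- induction.
theorem Walk.countP_support_le_countP_edges (I : Set V) {x y : V} (p : G.Walk x y) (hy : y ∉ I) :
    p.support.countP (· ∈ I) ≤ p.edges.countP (fun e => ∃ v ∈ e, v ∈ I) ∧
    (x ∉ I → 0 < p.support.countP (· ∈ I) →
      p.support.countP (· ∈ I) + 1 ≤ p.edges.countP (fun e => ∃ v ∈ e, v ∈ I)) := by
  induction p with
  | nil => simp [hy]
  | @cons x z y h q ih =>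
    obtain ⟨h₁, h₂⟩ := ih hy
    have hz : z ∈ I → 0 < q.support.countP (· ∈ I) := fun hz =>
      List.countP_pos_iff.2 ⟨z, q.start_mem_support, by simpa using hz⟩
    rw [Walk.support_cons, Walk.edges_cons, List.countP_cons, List.countP_cons]
    have hE : (∃ v ∈ s(x, z), v ∈ I) ↔ x ∈ I ∨ z ∈ I := by simp
    simp only [decide_eq_true_eq, hE]
    by_cases hxI : x ∈ I
    · simp only [hxI, if_true, true_or, not_true_eq_false, false_imp_iff, and_true]
      omega
    · by_cases hzI : z ∈ I
      · simp only [hxI, hzI, if_true, if_false, or_true]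
        exact ⟨by omega, fun _ _ => by omega⟩
      · simp only [hxI, hzI, if_false, or_self]
        exact ⟨h₁, fun _ => h₂ hzI⟩

theorem ncard_setOf_mem_filter {α : Type*} {l : List α} (hl : l.Nodup) (P : α → Prop)
    [DecidablePred P] : {x | x ∈ l ∧ P x}.ncard = l.countP P := by
  classical
  have : {x | x ∈ l ∧ P x} = ((l.filter P).toFinset : Set α) := by
    ext x
    simp
  rw [this, Set.ncard_coe_finset, List.toFinset_card_of_nodup (hl.filter _),
    List.countP_eq_length_filter]

/-- The inner vertices of a path in a given set are fewer than the edges of the path that meet this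
set. -/
theorem Walk.IsPath.ncard_lt_ncard_edges {x y : V} {p : G.Walk x y} (hp : p.IsPath) {I : Set V}
    (hx : x ∉ I) (hy : y ∉ I) (hI : ∀ z ∈ I, z ∈ p.support) (hne : I.Nonempty) :
    I.ncard + 1 ≤ {e | e ∈ p.edges ∧ ∃ v ∈ e, v ∈ I}.ncard ∧
      {e | e ∈ p.edges ∧ ∃ v ∈ e, v ∈ I}.ncard ≤ p.length := by
  classical
  have h₁ : I.ncard = p.support.countP (· ∈ I) := by
    rw [← ncard_setOf_mem_filter hp.support_nodup]
    congr 1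
    ext z
    exact ⟨fun h => ⟨hI z h, h⟩, fun h => h.2⟩
  rw [ncard_setOf_mem_filter hp.isTrail.edges_nodup, h₁]
  refine ⟨(p.countP_support_le_countP_edges I hy).2 hx ?_, ?_⟩
  · obtain ⟨z, hz⟩ := hne
    exact List.countP_pos_iff.2 ⟨z, hI z hz, by simpa using hz⟩
  · exact List.countP_le_length.trans_eq p.length_edges

/-- The edges of `F` inside the set `S`. -/
def restrictTo (F : SimpleGraph V) (S : Set V) : SimpleGraph V where
  Adj u v := F.Adj u v ∧ u ∈ S ∧ v ∈ S
  symm := ⟨fun _ _ h => ⟨h.1.symm, h.2.2, h.2.1⟩⟩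
  loopless := ⟨fun _ h => h.1.ne rfl⟩

theorem restrictTo_le (F : SimpleGraph V) (S : Set V) : F.restrictTo S ≤ F := fun _ _ h => h.1

end Forest

/-! ### Scaffolds: forests with a controlled vertex–edge ratio -/

namespace SetTreeDecomposition

variable {V : Type*} {G : SimpleGraph V} {K : Set V} {ι : Type}

/-- A forest in the cone of `s` all of whose components meet the part at `s`, and that is assembled
from paths of length at most `m + 1`: below every node `r` there are few vertices in comparison with
the number of edges. -/
structure IsScaffold (D : SetTreeDecomposition G K ι) (ρ : ι) (m : ℕ) (s : ι)
    (F : SimpleGraph V) : Prop where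
  le : F ≤ G
  isAcyclic : F.IsAcyclic
  mem_cone : ∀ u v, F.Adj u v → u ∈ D.cone ρ s
  exists_reachable : ∀ u ∈ F.support, ∃ x ∈ D.part s, F.Reachable u x
  count : ∀ r ∈ D.isTree.below ρ s,
    (m + 1) * (F.support ∩ (D.cone ρ r \ D.part r)).ncard ≤
      m * {e | e ∈ F.edgeSet ∧ ∀ x ∈ e, x ∈ D.cone ρ r}.ncard

theorem isScaffold_bot (D : SetTreeDecomposition G K ι) (ρ : ι) (m : ℕ) (s : ι) :
    D.IsScaffold ρ m s ⊥ where
  le := bot_le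
  isAcyclic := isAcyclic_bot
  mem_cone := fun _ _ h => absurd h (by simp)
  exists_reachable := by
    rintro u ⟨v, h⟩
    exact absurd h (by simp)
  count := by
    intro r _
    simp

/-- A walk of `F` towards the part at `t` cannot leave the cone of `r` before meeting the part at
`r`, so every component still reaches that part. The count is inherited because edges inside a lower
cone survive and no vertex is added. -/
theorem IsScaffold.restrictTo [Finite V] {D : SetTreeDecomposition G K ι} {ρ : ι} {m : ℕ}
    {t r : ι} {F : SimpleGraph V} (hF : D.IsScaffold ρ m t F) (hr : D.isTree.IsParent ρ t r) :
    D.IsScaffold ρ m r (F.restrictTo (D.cone ρ r)) where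
  le := (restrictTo_le _ _).trans hF.le
  isAcyclic := hF.isAcyclic.anti (restrictTo_le _ _)
  mem_cone := fun _ _ h => h.2.1
  exists_reachable := by
    have key : ∀ (u x : V) (p : F.Walk u x), x ∈ D.part t → u ∈ D.cone ρ r →
        ∃ y ∈ D.part r, (F.restrictTo (D.cone ρ r)).Reachable u y := by
      intro u x p hx hu
      induction p with
      | nil => exact ⟨_, D.part_inter_cone_subset hr.mem_below ⟨hx, hu⟩, .refl _⟩
      | @cons u v x h p ih =>
        by_cases hur : u ∈ D.part r
        · exact ⟨u, hur, .refl _⟩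
        · have hv := D.mem_cone_of_adj hu hur (hF.le h)
          obtain ⟨y, hy, hvy⟩ := ih hx hv
          have huv : (F.restrictTo (D.cone ρ r)).Adj u v := ⟨h, hu, hv⟩
          exact ⟨y, hy, huv.reachable.trans hvy⟩
    rintro u ⟨v, huv⟩
    obtain ⟨x, hx, ⟨p⟩⟩ := hF.exists_reachable u ⟨v, huv.1⟩
    exact key u x p hx huv.2.1
  count := by
    intro q hq
    refine le_trans ?_ ((hF.count q (D.isTree.below_subset hr.mem_below hq)).trans ?_)
    · exact Nat.mul_le_mul_left _ (Set.ncard_le_ncard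
        (Set.inter_subset_inter_left _ (support_mono (restrictTo_le _ _))) (Set.toFinite _))
    · refine Nat.mul_le_mul_left _ (Set.ncard_le_ncard ?_ (Set.toFinite _))
      rintro e ⟨he, he'⟩
      refine ⟨?_, he'⟩
      induction e with
      | _ x y =>
        exact ⟨he, D.cone_subset hq (he' x (by simp)), D.cone_subset hq (he' y (by simp))⟩

theorem IsScaffold.exists_lt [Finite V] {D : SetTreeDecomposition G K ι}
    (hD : D.SidesConnected) (hK : G.ConnectedOn K) {m : ℕ} (hgen : G.CyclesGenerate (m + 3))
    {ρ s : ι} {F : SimpleGraph V} (hF : D.IsScaffold ρ m s F) {x y : V} (hx : x ∈ D.part s)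
    (hy : y ∈ D.part s) (hxy : ¬ F.Reachable x y) : ∃ F', F < F' ∧ D.IsScaffold ρ m s F' := by
  classical
  -- The walks may also end at forest vertices. A shortest one between different components then has
  -- only new inner vertices, so adding it closes no cycle.
  let Z : Set V := D.part s ∪ F.support
  let P : ℕ → Prop := fun n => ∃ b ∈ Z, ∃ b' ∈ Z, ¬ F.Reachable b b' ∧ ∃ p : G.Walk b b',
    p.length ≤ n ∧ ∀ x ∈ p.support, x ∈ D.cone ρ s
  -- Reachability from `x` in `F` splits the part into two non-empty sets, which are joined by a
  -- short walk with `L = m + 1`.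
  have hPm : P (m + 1) := by
    obtain ⟨b, hb, b', hb', p, hpl, hp⟩ := D.exists_walk_cone_length_le hD hK hgen
      (Nat.le_add_left 1 m) ρ s (A := {v | v ∈ D.part s ∧ F.Reachable x v})
      (A' := {v | v ∈ D.part s ∧ ¬ F.Reachable x v}) ⟨x, hx, .refl x⟩ ⟨y, hy, hxy⟩
      (Set.disjoint_left.2 fun v hv hv' => hv'.2 hv.2) (by
        ext v
        simp only [Set.mem_union, Set.mem_ofPred_eq]
        tauto)
    exact ⟨b, Or.inl hb.1, b', Or.inl hb'.1, fun h => hb'.2 (hb.2.trans h), p, hpl, hp⟩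
  have hP : ∃ n, P n := ⟨_, hPm⟩
  have hmin : Nat.find hP ≤ m + 1 := Nat.find_min' hP hPm
  obtain ⟨b, hb, b', hb', hbb', p₀, hp₀l, hp₀⟩ := Nat.find_spec hP
  obtain ⟨p, hpp, hpl, hp⟩ : ∃ p : G.Walk b b', p.IsPath ∧ p.length ≤ Nat.find hP ∧
      ∀ x ∈ p.support, x ∈ D.cone ρ s :=
    ⟨p₀.bypass, p₀.bypass_isPath, (p₀.length_bypass_le_length).trans hp₀l,
      fun x hx => hp₀ x (p₀.support_bypass_subset_support hx)⟩
  have hint : ∀ z ∈ p.support, z ∈ Z → z = b ∨ z = b' := by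
    intro z hz hzZ
    by_contra! hcon
    have hlen := congrArg Walk.length (p.take_spec hz)
    rw [Walk.length_append] at hlen
    have h₁ : (p.takeUntil z hz).length ≠ 0 := fun h =>
      hcon.1 (Walk.eq_of_length_eq_zero h).symm
    have h₂ : (p.dropUntil z hz).length ≠ 0 := fun h => hcon.2 (Walk.eq_of_length_eq_zero h)
    by_cases hbz : F.Reachable b z
    · exact Nat.find_min hP (m := (p.dropUntil z hz).length) (by omega)
        ⟨z, hzZ, b', hb', fun h => hbb' (hbz.trans h), p.dropUntil z hz, le_rfl,
          fun y hy => hp y (p.support_dropUntil_subset_support hz hy)⟩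
    · exact Nat.find_min hP (m := (p.takeUntil z hz).length) (by omega)
        ⟨b, hb, z, hzZ, hbz, p.takeUntil z hz, le_rfl,
          fun y hy => hp y (p.support_takeUntil_subset_support hz hy)⟩
  let F' : SimpleGraph V := F ⊔ fromEdgeSet {e | e ∈ p.edges}
  have hpF' : ∀ e ∈ p.edges, e ∈ F'.edgeSet := by
    intro e he
    rw [edgeSet_sup, edgeSet_fromEdgeSet]
    exact Or.inr ⟨he, G.not_isDiag_of_mem_edgeSet (p.edges_subset_edgeSet he)⟩
  have hadj : ∀ u v, F'.Adj u v → F.Adj u v ∨ s(u, v) ∈ p.edges := by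
    rintro u v (h | h)
    exacts [Or.inl h, Or.inr h.1]
  have hsupp : ∀ u ∈ F'.support, u ∈ F.support ∨ u ∈ p.support := by
    rintro u ⟨v, huv⟩
    rcases hadj u v huv with h | h
    exacts [Or.inl ⟨v, h⟩, Or.inr (p.fst_mem_support_of_mem_edges h)]
  have hle : F ≤ F' := le_sup_left
  have hreach : ∀ u ∈ p.support, F'.Reachable u b := by
    intro u hu
    refine ⟨((p.takeUntil u hu).transfer F' fun e he => hpF' e ?_).reverse⟩
    exact p.edges_takeUntil_subset_edges hu he
  refine ⟨F', lt_of_le_of_ne hle ?_, ?_⟩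
  · intro h
    exact hbb' (h ▸ (hreach b' p.end_mem_support).symm)
  · refine ⟨?_, ?_, ?_, ?_, ?_⟩
    · intro u v huv
      rcases hadj u v huv with h | h
      exacts [hF.le h, p.adj_of_mem_edges h]
    · exact hF.isAcyclic.sup_edges_of_isPath p hpp hbb' fun z hz hzF => hint z hz (Or.inr hzF)
    · intro u v huv
      rcases hadj u v huv with h | h
      exacts [hF.mem_cone u v h, hp u (p.fst_mem_support_of_mem_edges h)]
    · intro u hu
      rcases hsupp u hu with hu | hu
      · obtain ⟨z, hz, huz⟩ := hF.exists_reachable u hu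
        exact ⟨z, hz, huz.mono hle⟩
      · rcases hb with hb | hb
        · exact ⟨b, hb, hreach u hu⟩
        · obtain ⟨z, hz, hbz⟩ := hF.exists_reachable b hb
          exact ⟨z, hz, (hreach u hu).trans (hbz.mono hle)⟩
    · intro r hr
      -- The new vertices to be counted at `r`. The ends of `p` are not among them, and every edge
      -- meeting `I` is new and stays in the cone of `r`.
      let I : Set V := {z | z ∈ p.support ∧ z ∈ D.cone ρ r \ D.part r ∧ z ∉ F.support}
      have hZI : ∀ z ∈ Z, z ∉ I := by
        rintro z (hz | hz) ⟨-, hzr, hzF⟩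
        · exact hzr.2 (D.part_inter_cone_subset hr ⟨hz, hzr.1⟩)
        · exact hzF hz
      have hn : (F'.support ∩ (D.cone ρ r \ D.part r)).ncard ≤
          (F.support ∩ (D.cone ρ r \ D.part r)).ncard + I.ncard := by
        refine le_trans (Set.ncard_le_ncard ?_ (Set.toFinite _)) (Set.ncard_union_le _ _)
        rintro z ⟨hz, hzr⟩
        by_cases hzF : z ∈ F.support
        · exact Or.inl ⟨hzF, hzr⟩
        · exact Or.inr ⟨(hsupp z hz).resolve_left hzF, hzr, hzF⟩
      have he : {e | e ∈ F.edgeSet ∧ ∀ x ∈ e, x ∈ D.cone ρ r}.ncard +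
          {e | e ∈ p.edges ∧ ∃ v ∈ e, v ∈ I}.ncard ≤
          {e | e ∈ F'.edgeSet ∧ ∀ x ∈ e, x ∈ D.cone ρ r}.ncard := by
        rw [← Set.ncard_union_eq ?_ (Set.toFinite _) (Set.toFinite _)]
        · refine Set.ncard_le_ncard ?_ (Set.toFinite _)
          rintro e (⟨he, he'⟩ | ⟨he, v, hve, hv⟩)
          · exact ⟨edgeSet_mono hle he, he'⟩
          · refine ⟨hpF' e he, fun w hw => ?_⟩
            by_cases hwv : w = v
            · exact hwv ▸ hv.2.1.1
            · have : e = s(v, w) := (Sym2.mem_and_mem_iff (Ne.symm hwv)).1 ⟨hve, hw⟩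
              rw [this] at he
              exact D.mem_cone_of_adj hv.2.1.1 hv.2.1.2 (p.adj_of_mem_edges he)
        · rw [Set.disjoint_left]
          rintro e ⟨he, -⟩ ⟨-, v, hve, hv⟩
          obtain ⟨w, rfl⟩ := hve
          exact hv.2.2 ⟨w, he⟩
      have hc := hF.count r hr
      rcases Set.eq_empty_or_nonempty I with hI | hI
      · rw [hI, Set.ncard_empty, add_zero] at hn
        calc _ ≤ (m + 1) * (F.support ∩ (D.cone ρ r \ D.part r)).ncard := by gcongr
          _ ≤ _ := hc
          _ ≤ _ := Nat.mul_le_mul_left _ (by omega)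
      · obtain ⟨h₁, h₂⟩ := hpp.ncard_lt_ncard_edges (hZI b hb) (hZI b' hb')
          (fun z hz => hz.1) hI
        -- At least `I.ncard + 1` edges of `p` meet `I`, and `p` has at most `m + 1` edges; hence
        -- `I.ncard ≤ m`, which is what the ratio needs.
        have h₃ : (m + 1) * I.ncard ≤ m * {e | e ∈ p.edges ∧ ∃ v ∈ e, v ∈ I}.ncard := by
          calc (m + 1) * I.ncard = m * I.ncard + I.ncard := by ring
            _ ≤ m * I.ncard + m := by gcongr; omega
            _ = m * (I.ncard + 1) := by ring
            _ ≤ _ := by gcongr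
        calc _ ≤ (m + 1) * ((F.support ∩ (D.cone ρ r \ D.part r)).ncard + I.ncard) := by gcongr
          _ = (m + 1) * (F.support ∩ (D.cone ρ r \ D.part r)).ncard + (m + 1) * I.ncard := by ring
          _ ≤ _ := add_le_add hc h₃
          _ = _ := by rw [← mul_add]
          _ ≤ _ := by gcongr

theorem IsScaffold.exists_le_forall_reachable [Finite V] {D : SetTreeDecomposition G K ι}
    (hD : D.SidesConnected) (hK : G.ConnectedOn K) {m : ℕ} (hgen : G.CyclesGenerate (m + 3))
    {ρ s : ι} {F : SimpleGraph V} (hF : D.IsScaffold ρ m s F) :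
    ∃ H, F ≤ H ∧ D.IsScaffold ρ m s H ∧ ∀ x ∈ D.part s, ∀ y ∈ D.part s, H.Reachable x y := by
  obtain ⟨H, hFH, hH⟩ := (Set.toFinite {H | D.IsScaffold ρ m s H}).exists_le_maximal hF
  refine ⟨H, hFH, hH.prop, fun x hx y hy => ?_⟩
  by_contra hxy
  obtain ⟨F', hlt, hF'⟩ := IsScaffold.exists_lt hD hK hgen hH.prop hx hy hxy
  exact hH.not_gt hF' hlt

/-- A part with two vertices already lies in `F.support`; the union matters for a single vertex,
where `F` may have no edge. -/
theorem IsScaffold.induce_isTree {D : SetTreeDecomposition G K ι} {m : ℕ} {ρ s : ι}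
    {F : SimpleGraph V} (hF : D.IsScaffold ρ m s F) (hne : (D.part s).Nonempty)
    (hr : ∀ x ∈ D.part s, ∀ y ∈ D.part s, F.Reachable x y) :
    (F.induce (D.part s ∪ F.support)).IsTree := by
  have hreach : ∀ u ∈ D.part s ∪ F.support, ∃ x ∈ D.part s, F.Reachable u x := by
    rintro u (hu | hu)
    exacts [⟨u, hu, .refl u⟩, hF.exists_reachable u hu]
  refine ⟨?_, hF.isAcyclic.induce _⟩
  obtain ⟨v, hv⟩ := hne
  have : Nonempty ↑(D.part s ∪ F.support) := ⟨v, Or.inl hv⟩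
  refine ⟨fun x y => ?_⟩
  obtain ⟨x', hx', hxx'⟩ := hreach x x.2
  obtain ⟨y', hy', hyy'⟩ := hreach y y.2
  obtain ⟨p⟩ := (hxx'.trans (hr x' hx' y' hy')).trans hyy'.symm
  have hp : ∀ z ∈ p.support, z ∈ D.part s ∪ F.support := by
    intro z hz
    rcases p.eq_or_mem_support hz with rfl | h
    exacts [x.2, Or.inr h]
  exact ⟨p.induce _ hp⟩

theorem IsScaffold.ncard_le [Finite V] {D : SetTreeDecomposition G K ι} {m : ℕ} {ρ s : ι}
    {F : SimpleGraph V} (hF : D.IsScaffold ρ m s F) (hne : (D.part s).Nonempty)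
    (hr : ∀ x ∈ D.part s, ∀ y ∈ D.part s, F.Reachable x y) {w : ℕ}
    (hw : (D.part s).ncard ≤ w + 1) :
    (D.part s ∪ F.support).ncard ≤ w * (m + 1) + 1 := by
  have htree := (isTree_iff_connected_and_card.1 (hF.induce_isTree hne hr)).2
  rw [Nat.card_coe_set_eq, Nat.card_coe_set_eq] at htree
  have hE : {e | e ∈ F.edgeSet ∧ ∀ x ∈ e, x ∈ D.cone ρ s}.ncard ≤
      (F.induce (D.part s ∪ F.support)).edgeSet.ncard := by
    refine le_trans (Set.ncard_le_ncard ?_ (Set.toFinite _))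
      (Set.ncard_image_le (f := Sym2.map Subtype.val) (Set.toFinite _))
    rintro e ⟨he, -⟩
    induction e with
    | _ x y =>
      have hxy : F.Adj x y := he
      exact ⟨s(⟨x, Or.inr ⟨y, hxy⟩⟩, ⟨y, Or.inr ⟨x, hxy.symm⟩⟩), hxy, rfl⟩
  have hN : (D.part s ∪ F.support).ncard =
      (D.part s).ncard + (F.support ∩ (D.cone ρ s \ D.part s)).ncard := by
    rw [← Set.ncard_union_eq ?_ (Set.toFinite _) (Set.toFinite _)]
    · congr 1
      ext x
      simp only [Set.mem_union, Set.mem_inter_iff, Set.mem_sdiff]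
      have : x ∈ F.support → x ∈ D.cone ρ s := fun ⟨y, hxy⟩ => hF.mem_cone x y hxy
      tauto
    · exact Set.disjoint_left.2 fun x hx hx' => hx'.2.2 hx
  have hc := hF.count s (D.isTree.self_mem_below ρ s)
  generalize (F.support ∩ (D.cone ρ s \ D.part s)).ncard = n at *
  generalize {e | e ∈ F.edgeSet ∧ ∀ x ∈ e, x ∈ D.cone ρ s}.ncard = e at *
  rw [hN] at htree ⊢
  -- With n vertices off the part, the tree has at most w + n edges. So (m + 1)n ≤ m(w + n), that is
  -- n ≤ mw, and the total is at most w + 1 + mw.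
  have h₁ : m * e + m ≤ m * (w + 1 + n) := by
    calc m * e + m = m * (e + 1) := by ring
      _ ≤ _ := Nat.mul_le_mul_left _ (by omega)
  nlinarith

end SetTreeDecomposition

/-! ### Assembling the connected tree-decomposition -/

namespace SetTreeDecomposition

variable {V : Type*} {G : SimpleGraph V} {K : Set V} {ι : Type}

/-- A tree-decomposition into non-empty parts with connected sides can be made connected by adding
short paths. -/
theorem exists_connected [Finite V] (D : SetTreeDecomposition G K ι)
    (hD : D.SidesConnected) (hK : G.ConnectedOn K) (hne : ∀ t, (D.part t).Nonempty) {m w : ℕ}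
    (hgen : G.CyclesGenerate (m + 3)) (hw : ∀ t, (D.part t).ncard ≤ w + 1) :
    ∃ D' : SetTreeDecomposition G K ι, ∀ t, (G.induce (D'.part t)).Connected ∧
      (D'.part t).ncard ≤ w * (m + 1) + 1 := by
  obtain ⟨ρ⟩ := D.isTree.connected.nonempty
  obtain ⟨f, hf, hfr⟩ := D.isTree.exists_rooted_choice ρ
    (fun t F => D.IsScaffold ρ m t F ∧ ∀ x ∈ D.part t, ∀ y ∈ D.part t, F.Reachable x y)
    -- Only vertices off the part at `r` must be handed down explicitly. All their neighbours lie in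
    -- the cone of `r`, so they keep their edges in the restriction.
    (fun _ r F H => ∀ v ∈ F.support, v ∈ D.cone ρ r → v ∉ D.part r → v ∈ H.support)
    (by
      obtain ⟨H, -, hH⟩ := (D.isScaffold_bot ρ m ρ).exists_le_forall_reachable hD hK hgen
      exact ⟨H, hH⟩)
    (by
      intro t r htr F hF
      obtain ⟨H, hle, hH⟩ := (hF.1.restrictTo htr).exists_le_forall_reachable hD hK hgen
      refine ⟨H, hH, ?_⟩
      rintro v ⟨u, hvu⟩ hvr hv
      exact ⟨u, hle ⟨hvu, hvr, D.mem_cone_of_adj hvr hv (hF.1.le hvu)⟩⟩)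
  have hcone : ∀ t, ∀ v ∈ (f t).support, v ∈ D.cone ρ t := by
    rintro t v ⟨u, huv⟩
    exact (hf t).1.mem_cone v u huv
  -- Descending from `t` towards `u`, an added vertex is inherited by each child's forest until some
  -- original part contains it; from there a walk of `D` finishes.
  have hdown : ∀ (v : V) (u : ι), v ∈ D.part u → ∀ (n : ℕ) (t : ι), u ∈ D.isTree.below ρ t →
      (D.isTree.trace ρ u).length = (D.isTree.trace ρ t).length + n →
      v ∈ D.part t ∪ (f t).support →
      ∃ p : D.tree.Walk t u, ∀ x ∈ p.support, v ∈ D.part x ∪ (f x).support := by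
    intro v u hvu n
    induction n with
    | zero =>
      intro t htu hlen _
      have hpre := D.isTree.trace_prefix htu
      obtain rfl := D.isTree.trace_injective (hpre.eq_of_length hlen.symm)
      exact ⟨.nil, by simp [hvu]⟩
    | succ n ih =>
      intro t htu hlen hv
      by_cases hvt : v ∈ D.part t
      · obtain ⟨p, hp⟩ := D.exists_walk v t u hvt hvu
        exact ⟨p, fun x hx => Or.inl (hp x hx)⟩
      · obtain ⟨r, hr, hur⟩ := D.isTree.exists_isParent_mem_below htu (by
          rintro rfl
          exact hvt hvu)
        have hvr : v ∈ D.part r ∪ (f r).support := by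
          by_cases h : v ∈ D.part r
          · exact Or.inl h
          · exact Or.inr (hfr t r hr v (hv.resolve_left hvt) ⟨u, hur, hvu⟩ h)
        have hlen' : (D.isTree.trace ρ r).length = (D.isTree.trace ρ t).length + 1 := by
          rw [hr]
          simp
        obtain ⟨p, hp⟩ := ih r hur (by omega) hvr
        refine ⟨.cons hr.adj p, fun x hx => ?_⟩
        rw [Walk.support_cons, List.mem_cons] at hx
        rcases hx with rfl | hx
        exacts [hv, hp x hx]
  have hbase : ∀ (v : V) (t : ι), v ∈ D.part t ∪ (f t).support → ∃ u, v ∈ D.part u ∧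
      ∃ p : D.tree.Walk t u, ∀ x ∈ p.support, v ∈ D.part x ∪ (f x).support := by
    intro v t hv
    obtain ⟨u, hu, hvu⟩ : v ∈ D.cone ρ t := by
      rcases hv with hv | hv
      exacts [D.part_subset_cone ρ t hv, hcone t v hv]
    have hle := (D.isTree.trace_prefix hu).length_le
    exact ⟨u, hvu, hdown v u hvu _ t hu (by omega :
      (D.isTree.trace ρ u).length = (D.isTree.trace ρ t).length +
        ((D.isTree.trace ρ u).length - (D.isTree.trace ρ t).length)) hv⟩
  let D' : SetTreeDecomposition G K ι :=
    { tree := D.tree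
      isTree := D.isTree
      part := fun t => D.part t ∪ (f t).support
      part_subset := by
        rintro t v (hv | hv)
        exacts [D.part_subset t hv, D.region_subset _ (hcone t v hv)]
      exists_mem_part := by
        intro v hv
        obtain ⟨t, ht⟩ := D.exists_mem_part v hv
        exact ⟨t, Or.inl ht⟩
      exists_adj_mem_part := by
        intro v hv u hvu
        obtain ⟨t, ht, ht'⟩ := D.exists_adj_mem_part v hv u hvu
        exact ⟨t, Or.inl ht, Or.inl ht'⟩
      exists_walk := by
        intro v t₁ t₂ h₁ h₂
        obtain ⟨u₁, hu₁, p₁, hp₁⟩ := hbase v t₁ h₁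
        obtain ⟨u₂, hu₂, p₂, hp₂⟩ := hbase v t₂ h₂
        obtain ⟨p, hp⟩ := D.exists_walk v u₁ u₂ hu₁ hu₂
        refine ⟨(p₁.append p).append p₂.reverse, fun x hx => ?_⟩
        rw [Walk.mem_support_append_iff, Walk.mem_support_append_iff, Walk.support_reverse,
          List.mem_reverse] at hx
        rcases hx with (hx | hx) | hx
        exacts [hp₁ x hx, Or.inl (hp x hx), hp₂ x hx] }
  refine ⟨D', fun t => ⟨?_, (hf t).1.ncard_le (hne t) (hf t).2 (hw t)⟩⟩
  exact ((hf t).1.induce_isTree (hne t) (hf t).2).connected.mono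
    (comap_monotone _ (hf t).1.le)

/-- A tree-decomposition of the set of all vertices is a tree-decomposition of the graph. -/
def toTreeDecomposition (D : SetTreeDecomposition G Set.univ ι) : TreeDecomposition G ι where
  tree := D.tree
  isTree := D.isTree
  part := D.part
  exists_mem_part := fun v => D.exists_mem_part v trivial
  exists_adj_mem_part := fun v => D.exists_adj_mem_part v trivial
  inter_subset_part := by
    classical
    rintro t₁ t₃ p hp t₂ h₂ v ⟨hv₁, hv₃⟩
    obtain ⟨q, hq⟩ := D.exists_walk v t₁ t₃ hv₁ hv₃
    rw [D.isTree.eq_of_isPath hp q.bypass_isPath] at h₂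
    exact hq t₂ (q.support_bypass_subset_support h₂)

end SetTreeDecomposition

/-! ### Passing to components and back -/

namespace TreeDecomposition

variable {V : Type*} {G : SimpleGraph V} {ι : Type}

/-- The restriction of a tree-decomposition to a component. -/
def restrictComponent (D : TreeDecomposition G ι) (c : G.ConnectedComponent) :
    SetTreeDecomposition G c.supp ι where
  tree := D.tree
  isTree := D.isTree
  part := fun t => D.part t ∩ c.supp
  part_subset := fun _ => Set.inter_subset_right
  exists_mem_part := by
    intro v hv
    obtain ⟨t, ht⟩ := D.exists_mem_part v
    exact ⟨t, ht, hv⟩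
  exists_adj_mem_part := by
    intro v hv w hvw
    obtain ⟨t, ht, ht'⟩ := D.exists_adj_mem_part v w hvw
    refine ⟨t, ⟨ht, hv⟩, ht', ?_⟩
    rw [ConnectedComponent.mem_supp_iff] at hv ⊢
    rw [← hv]
    exact ConnectedComponent.sound hvw.symm.reachable
  exists_walk := by
    rintro v t₁ t₂ ⟨h₁, hv⟩ ⟨h₂, -⟩
    obtain ⟨p, hp, -⟩ := D.isTree.existsUnique_path t₁ t₂
    exact ⟨p, fun t ht => ⟨D.inter_subset_part t₁ t₂ p hp t ht ⟨h₁, h₂⟩, hv⟩⟩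

theorem ncard_part_le [Finite ι] (D : TreeDecomposition G ι) (t : ι) :
    (D.part t).ncard ≤ D.width + 1 := by
  have : (D.part t).ncard - 1 ≤ D.width :=
    le_ciSup (f := fun t => (D.part t).ncard - 1) (Set.finite_range _).bddAbove t
  omega

/-- The bound for tree-decompositions, in case the cycles of length at most `m + 3` generate the
cycle space. -/
theorem exists_isConnected_width_le [Finite V] [Nonempty V] [Finite ι]
    (D : TreeDecomposition G ι) {m : ℕ} (hgen : G.CyclesGenerate (m + 3)) :
    ∃ (κ : Type) (_ : Finite κ) (D' : TreeDecomposition G κ), D'.IsConnected ∧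
      D'.width ≤ D.width * (m + 1) := by
  classical
  have := Fintype.ofFinite G.ConnectedComponent
  have hcomp : ∀ c : G.ConnectedComponent,
      ∃ (κ : Type) (_ : Finite κ) (D' : SetTreeDecomposition G c.supp κ),
        ∀ t, (G.induce (D'.part t)).Connected ∧
          (D'.part t).ncard ≤ D.width * (m + 1) + 1 := by
    intro c
    obtain ⟨κ, hκ, D₁, hD₁, hne, hn⟩ := (D.restrictComponent c).exists_sidesConnected
      c.connectedOn_supp c.nonempty_supp (n := D.width + 1)
      (fun t => (Set.ncard_le_ncard Set.inter_subset_left (Set.toFinite _)).trans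
        (D.ncard_part_le t))
    exact ⟨κ, hκ, D₁.exists_connected hD₁ c.connectedOn_supp hne hgen hn⟩
  -- The decompositions of the components are joined one at a time; the set of components is
  -- non-empty, so no empty part is needed.
  have hall : ∀ S : Finset G.ConnectedComponent, S.Nonempty →
      ∃ (κ : Type) (_ : Finite κ)
        (D' : SetTreeDecomposition G {v | G.connectedComponentMk v ∈ S} κ),
        ∀ t, (G.induce (D'.part t)).Connected ∧
          (D'.part t).ncard ≤ D.width * (m + 1) + 1 := by
    intro S hS
    induction hS using Finset.Nonempty.cons_induction with
    | singleton c =>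
      have : {v | G.connectedComponentMk v ∈ ({c} : Finset _)} = c.supp := by
        ext v
        simp
      rw [this]
      exact hcomp c
    | cons c S hc hS ih =>
      have : {v | G.connectedComponentMk v ∈ Finset.cons c S hc} =
          c.supp ∪ {v | G.connectedComponentMk v ∈ S} := by
        ext v
        simp
      rw [this]
      obtain ⟨κ₁, _, D₁, hD₁⟩ := hcomp c
      obtain ⟨κ₂, _, D₂, hD₂⟩ := ih
      obtain ⟨s⟩ := D₁.isTree.connected.nonempty
      obtain ⟨r⟩ := D₂.isTree.connected.nonempty
      refine ⟨κ₁ ⊕ κ₂, inferInstance, D₁.join D₂ ?_ s r, ?_⟩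
      · rw [Set.disjoint_left]
        intro v hv hv'
        rw [ConnectedComponent.mem_supp_iff] at hv
        exact hc (hv ▸ hv')
      · rintro (t | t)
        exacts [hD₁ t, hD₂ t]
  obtain ⟨κ, hκ, D', hD'⟩ := hall Finset.univ Finset.univ_nonempty
  have huniv : {v | G.connectedComponentMk v ∈ Finset.univ} = Set.univ := by simp
  revert D'
  rw [huniv]
  intro D' hD'
  refine ⟨κ, hκ, D'.toTreeDecomposition, fun t => (hD' t).1, ?_⟩
  have := D'.isTree.connected.nonempty
  refine ciSup_le fun t => ?_
  have : (D'.toTreeDecomposition.part t).ncard ≤ D.width * (m + 1) + 1 := (hD' t).2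
  omega

end TreeDecomposition

/-! ### The generating length of the cycle space -/

section CycleGeneratingLength

variable {V : Type*} {G : SimpleGraph V}

theorem cyclesGenerate_cycleGeneratingLength [Finite V] (G : SimpleGraph V) :
    G.CyclesGenerate G.cycleGeneratingLength := by
  classical
  have := Fintype.ofFinite V
  -- A cycle repeats no edge, so the number of edges of `G` bounds all cycle lengths and the infimum
  -- is attained.
  refine Nat.sInf_mem (s := {l | G.CyclesGenerate l}) ⟨G.edgeFinset.card, ?_⟩
  refine congrArg (Submodule.span (ZMod 2)) ?_
  ext x
  constructor
  · rintro ⟨v, c, hc, -, rfl⟩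
    exact ⟨v, c, hc, rfl⟩
  · rintro ⟨v, c, hc, rfl⟩
    exact ⟨v, c, hc, hc.isTrail.length_le_card_edgeFinset, rfl⟩

/-- Below 3 there are no generators, whereas the vector of a cycle is non-zero. This allows ℓ to be
written as `m + 3`. -/
theorem CyclesGenerate.three_le {l : ℕ} (hl : G.CyclesGenerate l) {v : V} {c : G.Walk v v}
    (hc : c.IsCycle) : 3 ≤ l := by
  by_contra h
  have hempty : {x | ∃ (v : V) (c : G.Walk v v), c.IsCycle ∧ c.length ≤ l ∧ c.edgeVector = x} =
      ∅ := by
    refine Set.eq_empty_of_forall_notMem ?_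
    rintro x ⟨u, d, hd, hdl, -⟩
    have := hd.three_le_length
    omega
  have hmem : c.edgeVector ∈ G.cycleSpace := Submodule.subset_span ⟨v, c, hc, rfl⟩
  rw [← hl, hempty, Submodule.span_empty, Submodule.mem_bot] at hmem
  cases c with
  | nil => exact Walk.not_isCycle_nil hc
  | @cons _ w _ h p =>
    have := congrFun hmem s(v, w)
    simp [Walk.edgeVector] at this

end CycleGeneratingLength

end SimpleGraph

theorem mainTheorem1 {V : Type*} [Finite V] (G : SimpleGraph V)
    (hG : ∃ (v : V) (c : G.Walk v v), c.IsCycle) :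
    (G.connectedTreeWidth : ℤ) ≤ (G.treeWidth : ℤ) * ((G.cycleGeneratingLength : ℤ) - 2) := by
  obtain ⟨v, c, hc⟩ := hG
  have : Nonempty V := ⟨v⟩
  have hgen := G.cyclesGenerate_cycleGeneratingLength
  obtain ⟨m, hm⟩ := Nat.exists_eq_add_of_le' (hgen.three_le hc)
  rw [hm] at hgen
  obtain ⟨ι, hι, D, hD⟩ := Nat.sInf_mem G.treeDecompositionWidths_nonempty
  obtain ⟨κ, hκ, D', hD', hw⟩ := D.exists_isConnected_width_le hgen
  have hle : G.connectedTreeWidth ≤ D'.width := Nat.sInf_le ⟨κ, hκ, D', hD', rfl⟩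
  have hD₂ : D.width = G.treeWidth := hD
  rw [hD₂] at hw
  rw [hm]
  push_cast
  have h : (G.connectedTreeWidth : ℤ) ≤ (G.treeWidth : ℤ) * ((m : ℤ) + 1) := by
    exact_mod_cast hle.trans hw
  convert h using 2
  ring
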